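/- Let $k$ be an algebraically closed field of characteristic $0$, $q\in k^{*}$, and for $r\ge 0$ put $[r]=q^{r-1}+q^{r-3}+\dots+q^{1-r}\in k$ (so $[r]=\frac{q^{r}-q^{-r}}{q-q^{-1}}$ if $q\neq\pm1$). Let $\mathrm{char}(q)=\ell$ be the least positive integer with $[\ell]=0$, and assume $\ell\ge 3$. Let $n\ge 3$, $m\ge 1$. Let $U_q(\mathfrak{sl}_n)$ be the $k$-algebra with the standard generators $e_i,f_i,K_i^{\pm1}$ ($1\le i\le n-1$) and the standard (quantum Serre) relations, and let $u=\mathfrak u_q(\mathfrak{sl}_n)=U_q(\mathfrak{sl}_n)/(e_i^{\ell},\,f_i^{\ell},\,K_i^{2\ell}-1 : 1\le i\le n-1)$. It acts on the underlying space $\bigoplus_{\alpha\in\mathbb Z_{\ge 0}^{n}}k\,x^{(\alpha)}$ of the quantum divided power algebra $\mathcal A_q(n)$ by $$e_i x^{(\beta)}=[\beta_i+1]\,x^{(\beta+\varepsilon_i-\varepsilon_{i+1})},\qquad f_i x^{(\beta)}=[\beta_{i+1}+1]\,x^{(\beta-\varepsilon_i+\varepsilon_{i+1})},\qquad K_i^{\pm1}x^{(\beta)}=q^{\pm(\beta_i-\beta_{i+1})}x^{(\beta)},$$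 where $x^{(\gamma)}=0$ if $\gamma$ has a negative entry. Put $N=n(m\ell-1)$. For $0\le s\le N$ let $\mathbb Z_+^n(s,\mathbf m)$ be the set of $\alpha\in\mathbb Z_{\ge0}^n$ with $|\alpha|=\sum_i\alpha_i=s$ and all $\alpha_i\le m\ell-1$, and let $\mathcal A=\mathcal A_q^{(s)}(n,\mathbf m)$ be the span of the $x^{(\alpha)}$ with $\alpha\in\mathbb Z_+^n(s,\mathbf m)$; it is a $u$-submodule. The energy degree of $x^{(\alpha)}$ is $\sum_i\lfloor\alpha_i/\ell\rfloor$, and the energy degree of a nonzero $y\in\mathcal A$ is the largest energy degree of a monomial occurring in $y$. Let $E(s)_0$ and $E(s)$ be the smallest and the largest energy degree of nonzero elements of $\mathcal A$. For a vector $y$ put $\mathfrak V_y=u\cdot y$, and write $\mathfrak V_\alpha=u\cdot x^{(\alpha)}$. A highest weight vector of a module is a nonzero vector that generates it, is an eigenvector of all $K_i$, and is annihilated by all $e_i$. Then the following hold. 1. If $0\neq y\in\mathcal A$ and $\mathfrak V_y$ is simple, then $y$ has energy degree $E(s)_0$. 2. $\operatorname{Soc}\mathcal A$ is the $k$-span of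 the $x^{(\alpha)}$, $\alpha\in\mathbb Z_+^n(s,\mathbf m)$, of energy degree $E(s)_0$. 3. $\mathcal A=\sum_\alpha \mathfrak V_\alpha$, the sum over the $\alpha\in\mathbb Z_+^n(s,\mathbf m)$ such that $x^{(\alpha)}$ has energy degree $E(s)$. 4. If $0\le s\le\ell-1$ or $N-(\ell-1)\le s\le N$, then $\mathcal A=\mathfrak V_\eta$ is simple with highest weight vector $x^{(\eta)}$, where $\eta=(s,0,\dots,0)$ in the first case, and in the second $\eta=(m\ell-1,\dots,m\ell-1,(m-1)\ell+h)$ with $s=n(m-1)\ell+(n-1)(\ell-1)+h$, $0\le h\le\ell-1$. 5. If $\ell\le s\le N-\ell$, then $\mathcal A$ is indecomposable. Moreover: (i) if $\ell\le s\le n(\ell-1)$, then $\operatorname{Soc}\mathcal A=\mathfrak V_\eta$ is simple with highest weight vector $x^{(\eta)}$, where $\eta=(\ell-1,\dots,\ell-1,h,0,\dots,0)$ has $j$ entries $\ell-1$ before the entry $h$, and $s=j(\ell-1)+h$ with $1\le j<n$, $1\le h\le\ell-1$; (ii) if $n(\ell-1)+1\le s\le N-\ell$, then, writing $s=r\ell+h+(n-1)(\ell-1)$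 with $1\le r\le n(m-1)-1$ and $0\le h\le\ell-1$, one has $\operatorname{Soc}\mathcal A=\bigoplus_{\kappa}\mathfrak V_{\eta(\kappa)}$, and this is not simple; here $\kappa$ runs over the $n$-tuples of integers $0\le\kappa_i\le m-1$ with $\sum_i\kappa_i=r$, and $\eta(\kappa)=(\kappa_1\ell+\ell-1,\dots,\kappa_{n-1}\ell+\ell-1,\kappa_n\ell+h)$; each $x^{(\eta(\kappa))}$ is a highest weight vector of $\mathfrak V_{\eta(\kappa)}$. -/

import Mathlib

/-! Homogeneous components of the truncated quantum divided power algebra, as modules over the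
restricted quantum group `u_q(sl_n)`. -/

namespace QDP

noncomputable section

open Finset

variable {k : Type*} [Field k]

/-! ### Quantum integers and the characteristic of `q` -/

/-- The quantum integer `[r] = (q^r - q^{-r}) / (q - q^{-1})`, written as the Laurent polynomial
`q^{r-1} + q^{r-3} + ⋯ + q^{1-r}`, so that it has the right value also for `q = ±1`. -/
def qInt (q : kˣ) (r : ℕ) : k :=
  ∑ t ∈ range r, ((q ^ ((r : ℤ) - 1 - 2 * (t : ℤ)) : kˣ) : k)

/-- The characteristic of `q`: the least positive `ℓ` with `[ℓ] = 0`, and `0` if there is none. -/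
def qChar (q : kˣ) : ℕ := sInf {r : ℕ | 0 < r ∧ qInt q r = 0}

lemma qInt_zero (q : kˣ) : qInt q 0 = 0 := by simp [qInt]

lemma qInt_succ (q : kˣ) (r : ℕ) :
    qInt q (r + 1) = (q : k) * qInt q r + ((q ^ (-(r : ℤ)) : kˣ) : k) := by
  unfold qInt
  rw [sum_range_succ, mul_sum]
  congr 1
  · refine sum_congr rfl fun t _ => ?_
    rw [← Units.val_mul, ← zpow_one_add]
    congr 2
    push_cast
    ring
  · congr 2
    push_cast
    ring

lemma sub_mul_qInt (q : kˣ) (r : ℕ) :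
    ((q : k) - ((q⁻¹ : kˣ) : k)) * qInt q r
      = ((q ^ (r : ℤ) : kˣ) : k) - ((q ^ (-(r : ℤ)) : kˣ) : k) := by
  induction r with
  | zero => simp [qInt_zero]
  | succ r ih =>
    rw [qInt_succ, mul_add, mul_left_comm, ih]
    have hq : (q : k) ≠ 0 := q.ne_zero
    push_cast [zpow_neg, zpow_add₀ hq]
    simp only [zpow_natCast, zpow_one, mul_inv]
    field_simp
    ring

lemma qInt_add (q : kˣ) (a b : ℕ) :
    qInt q (a + b) = ((q ^ (b : ℤ) : kˣ) : k) * qInt q a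
      + ((q ^ (-(a : ℤ)) : kˣ) : k) * qInt q b := by
  have hq : (q : k) ≠ 0 := q.ne_zero
  induction b with
  | zero => simp [qInt_zero]
  | succ b ih =>
    rw [← add_assoc, qInt_succ, ih, qInt_succ]
    push_cast [zpow_neg, zpow_add₀ hq]
    simp only [zpow_natCast, zpow_one, mul_inv]
    field_simp
    ring

lemma qInt_cross (q : kˣ) (a b : ℕ) :
    ((q : k) - ((q⁻¹ : kˣ) : k)) * (qInt q a * qInt q (b + 1) - qInt q (a + 1) * qInt q b)
      = ((q ^ ((a : ℤ) - b) : kˣ) : k) - ((q ^ ((b : ℤ) - a) : kˣ) : k) := by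
  have h : ((q : k) - ((q⁻¹ : kˣ) : k))
      * (qInt q a * qInt q (b + 1) - qInt q (a + 1) * qInt q b)
      = (((q : k) - ((q⁻¹ : kˣ) : k)) * qInt q a) * ((q ^ (-(b : ℤ)) : kˣ) : k)
        - (((q : k) - ((q⁻¹ : kˣ) : k)) * qInt q b) * ((q ^ (-(a : ℤ)) : kˣ) : k) := by
    rw [qInt_succ, qInt_succ]; ring
  rw [h, sub_mul_qInt, sub_mul_qInt]
  simp only [sub_mul, ← Units.val_mul, ← zpow_add]
  rw [add_comm (-(b : ℤ)) (-(a : ℤ))]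
  simp only [← sub_eq_add_neg]
  ring

lemma qInt_serre (q : kˣ) (c : ℕ) :
    qInt q (c + 2) + qInt q c = qInt q 2 * qInt q (c + 1) := by
  have hq : (q : k) ≠ 0 := q.ne_zero
  have h2 : qInt q 2 = (q : k) + (q : k)⁻¹ := by
    rw [qInt_succ q 1, qInt_succ q 0, qInt_zero]; simp
  rw [h2, qInt_succ q (c + 1), qInt_succ q c]
  push_cast [zpow_neg, zpow_add₀ hq]
  simp only [zpow_natCast, zpow_one, mul_inv]
  field_simp
  ring

lemma qInt_qChar (q : kˣ) : qInt q (qChar q) = 0 := by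
  unfold qChar
  rcases Set.eq_empty_or_nonempty {r : ℕ | 0 < r ∧ qInt q r = 0} with h | h
  · rw [h]; simp [qInt_zero]
  · exact (Nat.sInf_mem h).2

lemma qInt_mul_qChar (q : kˣ) (m : ℕ) : qInt q (m * qChar q) = 0 := by
  induction m with
  | zero => simp [qInt_zero]
  | succ m ih => rw [Nat.succ_mul, qInt_add, ih, qInt_qChar]; simp

lemma q_pow_two_qChar (q : kˣ) : q ^ (2 * (qChar q : ℤ)) = 1 := by
  have h := sub_mul_qInt q (qChar q)
  rw [qInt_qChar, mul_zero, eq_comm, sub_eq_zero, Units.val_inj] at h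
  rw [two_mul, zpow_add]
  nth_rewrite 1 [h]
  simp

/-! ### The quantum groups `U_q(sl_n)` and `u_q(sl_n)` -/

/-- The generators `e_i, f_i, K_i, K_i⁻¹` (`1 ≤ i ≤ n - 1`). -/
inductive Gen (n : ℕ) : Type
  | e (i : Fin (n - 1))
  | f (i : Fin (n - 1))
  | K (i : Fin (n - 1))
  | Kinv (i : Fin (n - 1))

/-- The entries of the Cartan matrix of type `A_{n-1}`. -/
def cartan {n : ℕ} (i j : Fin (n - 1)) : ℤ :=
  if i = j then 2 else if i.val + 1 = j.val ∨ j.val + 1 = i.val then -1 else 0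

/-- A generator as an element of the free algebra. -/
abbrev gen (k : Type*) [Field k] {n : ℕ} (g : Gen n) : FreeAlgebra k (Gen n) := FreeAlgebra.ι k g

open Gen in
/-- The defining relations of `U_q(sl_n)`. The relation
`e_i f_j - f_j e_i = δ_{ij} (K_i - K_i⁻¹) / (q - q⁻¹)` is multiplied by `q - q⁻¹`, which is a
non-zero scalar as soon as `q ≠ ±1`. -/
inductive URel (q : kˣ) (n : ℕ) : FreeAlgebra k (Gen n) → FreeAlgebra k (Gen n) → Prop
  | K_mul_Kinv (i : Fin (n - 1)) : URel q n (gen k (K i) * gen k (Kinv i)) 1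
  | Kinv_mul_K (i : Fin (n - 1)) : URel q n (gen k (Kinv i) * gen k (K i)) 1
  | K_comm (i j : Fin (n - 1)) :
      URel q n (gen k (K i) * gen k (K j)) (gen k (K j) * gen k (K i))
  | K_e (i j : Fin (n - 1)) :
      URel q n (gen k (K i) * gen k (e j) * gen k (Kinv i))
        (((q ^ cartan i j : kˣ) : k) • gen k (e j))
  | K_f (i j : Fin (n - 1)) :
      URel q n (gen k (K i) * gen k (f j) * gen k (Kinv i))
        (((q ^ (-cartan i j) : kˣ) : k) • gen k (f j))
  | e_f (i j : Fin (n - 1)) :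
      URel q n (((q : k) - ((q⁻¹ : kˣ) : k)) • (gen k (e i) * gen k (f j) - gen k (f j) * gen k (e i)))
        (if i = j then gen k (K i) - gen k (Kinv i) else 0)
  | e_comm (i j : Fin (n - 1)) (h : cartan i j = 0) :
      URel q n (gen k (e i) * gen k (e j)) (gen k (e j) * gen k (e i))
  | f_comm (i j : Fin (n - 1)) (h : cartan i j = 0) :
      URel q n (gen k (f i) * gen k (f j)) (gen k (f j) * gen k (f i))
  | e_serre (i j : Fin (n - 1)) (h : cartan i j = -1) :
      URel q n (gen k (e i) * gen k (e i) * gen k (e j)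
        - qInt q 2 • (gen k (e i) * gen k (e j) * gen k (e i))
        + gen k (e j) * gen k (e i) * gen k (e i)) 0
  | f_serre (i j : Fin (n - 1)) (h : cartan i j = -1) :
      URel q n (gen k (f i) * gen k (f i) * gen k (f j)
        - qInt q 2 • (gen k (f i) * gen k (f j) * gen k (f i))
        + gen k (f j) * gen k (f i) * gen k (f i)) 0

/-- The quantum group `U_q(sl_n)`. -/
def BigU (q : kˣ) (n : ℕ) : Type _ := RingQuot (URel q n)

instance (q : kˣ) (n : ℕ) : Ring (BigU q n) := inferInstanceAs (Ring (RingQuot (URel q n)))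

instance (q : kˣ) (n : ℕ) : Algebra k (BigU q n) :=
  inferInstanceAs (Algebra k (RingQuot (URel q n)))

/-- The quotient map onto `U_q(sl_n)`. -/
def mkU (q : kˣ) (n : ℕ) : FreeAlgebra k (Gen n) →ₐ[k] BigU q n := RingQuot.mkAlgHom k (URel q n)

/-- The generators of `U_q(sl_n)`. -/
def genU (q : kˣ) {n : ℕ} (g : Gen n) : BigU q n := mkU q n (gen k g)

/-- The additional relations `e_i^ℓ = 0`, `f_i^ℓ = 0`, `K_i^{2ℓ} = 1`, where `ℓ` is the
characteristic of `q`; they are imposed only if this is positive. -/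
inductive uRel (q : kˣ) (n : ℕ) : BigU q n → BigU q n → Prop
  | e_pow (i : Fin (n - 1)) (h : 0 < qChar q) : uRel q n (genU q (Gen.e i) ^ qChar q) 0
  | f_pow (i : Fin (n - 1)) (h : 0 < qChar q) : uRel q n (genU q (Gen.f i) ^ qChar q) 0
  | K_pow (i : Fin (n - 1)) (h : 0 < qChar q) : uRel q n (genU q (Gen.K i) ^ (2 * qChar q)) 1

/-- The restricted quantum group `u_q(sl_n) = U_q(sl_n) / (e_i^ℓ, f_i^ℓ, K_i^{2ℓ} - 1)`. -/
def SmallU (q : kˣ) (n : ℕ) : Type _ := RingQuot (uRel q n)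

instance (q : kˣ) (n : ℕ) : Ring (SmallU q n) := inferInstanceAs (Ring (RingQuot (uRel q n)))

instance (q : kˣ) (n : ℕ) : Algebra k (SmallU q n) :=
  inferInstanceAs (Algebra k (RingQuot (uRel q n)))

/-- The quotient map from `U_q(sl_n)` onto `u_q(sl_n)`. -/
def mku (q : kˣ) (n : ℕ) : BigU q n →ₐ[k] SmallU q n := RingQuot.mkAlgHom k (uRel q n)

/-- The generators of `u_q(sl_n)`. -/
def genu (q : kˣ) {n : ℕ} (g : Gen n) : SmallU q n := mku q n (genU q g)

/-! ### The space `A_q(n)` and the action on it -/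

/-- The vector space underlying the quantum divided power algebra, with its basis of divided
powers `x^(α)`, `α ∈ ℕ^n`. -/
abbrev DivPow (k : Type*) [Field k] (n : ℕ) : Type _ := (Fin n → ℕ) →₀ k

/-- The basis element `x^(α)`. -/
def mono (k : Type*) [Field k] {n : ℕ} (α : Fin n → ℕ) : DivPow k n := Finsupp.single α 1

/-- The exponent `β + ε_a - ε_b`. -/
def shift {n : ℕ} (a b : Fin n) (β : Fin n → ℕ) : Fin n → ℕ := fun t =>
  β t + (if t = a then 1 else 0) - (if t = b then 1 else 0)

/-- The operator `x^(β) ↦ [β_a + 1] x^(β + ε_a - ε_b)` for `a ≠ b`, where `x^(γ) = 0` if `γ` has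
a negative entry. -/
def moveOp (q : kˣ) {n : ℕ} (a b : Fin n) : Module.End k (DivPow k n) :=
  Finsupp.linearCombination k fun β : Fin n → ℕ =>
    if β b = 0 then 0 else qInt q (β a + 1) • mono k (shift a b β)

/-- The operator `x^(β) ↦ q^(β_a - β_b) x^(β)`. -/
def diagOp (q : kˣ) {n : ℕ} (a b : Fin n) : Module.End k (DivPow k n) :=
  Finsupp.linearCombination k fun β : Fin n → ℕ =>
    ((q ^ ((β a : ℤ) - (β b : ℤ)) : kˣ) : k) • mono k β

/-- The position `i` among `1, …, n`. -/
def lo {n : ℕ} (i : Fin (n - 1)) : Fin n := ⟨i.val, by omega⟩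

/-- The position `i + 1` among `1, …, n`. -/
def hi {n : ℕ} (i : Fin (n - 1)) : Fin n := ⟨i.val + 1, by omega⟩

/-- The action of the generators:
`e_i x^(β) = [β_i + 1] x^(β + ε_i - ε_{i+1})`, `f_i x^(β) = [β_{i+1} + 1] x^(β - ε_i + ε_{i+1})`,
`K_i^{±1} x^(β) = q^{±(β_i - β_{i+1})} x^(β)`. -/
def genOp (q : kˣ) {n : ℕ} : Gen n → Module.End k (DivPow k n)
  | .e i => moveOp q (lo i) (hi i)
  | .f i => moveOp q (hi i) (lo i)
  | .K i => diagOp q (lo i) (hi i)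
  | .Kinv i => diagOp q (hi i) (lo i)

lemma moveOp_mono (q : kˣ) {n : ℕ} (a b : Fin n) (β : Fin n → ℕ) :
    moveOp q a b (mono k β) =
      if β b = 0 then 0 else qInt q (β a + 1) • mono k (shift a b β) := by
  simp [moveOp, mono]

lemma diagOp_mono (q : kˣ) {n : ℕ} (a b : Fin n) (β : Fin n → ℕ) :
    diagOp q a b (mono k β) = ((q ^ ((β a : ℤ) - (β b : ℤ)) : kˣ) : k) • mono k β := by
  simp [diagOp, mono]

lemma end_ext {n : ℕ} {S T : Module.End k (DivPow k n)}
    (h : ∀ β, S (mono k β) = T (mono k β)) : S = T := by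
  refine Finsupp.lhom_ext fun β c => ?_
  have h1 : (Finsupp.single β c : DivPow k n) = c • mono k β := by simp [mono]
  rw [h1, map_smul, map_smul, h]

lemma lo_ne_hi {n : ℕ} (i : Fin (n - 1)) : lo i ≠ hi i := by
  simp [lo, hi, Fin.ext_iff]

lemma moveOp_zero (q : kˣ) {n : ℕ} {a b : Fin n} {β : Fin n → ℕ} (h : β b = 0) :
    moveOp q a b (mono k β) = 0 := by
  rw [moveOp_mono, if_pos h]

lemma moveOp_pos (q : kˣ) {n : ℕ} {a b : Fin n} {β : Fin n → ℕ} (h : β b ≠ 0) :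
    moveOp q a b (mono k β) = qInt q (β a + 1) • mono k (shift a b β) := by
  rw [moveOp_mono, if_neg h]

lemma shift_src {n : ℕ} {a b : Fin n} (hab : a ≠ b) (β : Fin n → ℕ) :
    shift a b β a = β a + 1 := by simp [shift, hab]

lemma shift_tgt {n : ℕ} {a b : Fin n} (hab : a ≠ b) (β : Fin n → ℕ) :
    shift a b β b = β b - 1 := by simp [shift, hab.symm]

lemma shift_of_ne {n : ℕ} {a b t : Fin n} (ha : t ≠ a) (hb : t ≠ b) (β : Fin n → ℕ) :
    shift a b β t = β t := by simp [shift, ha, hb]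

lemma diagOp_comm (q : kˣ) {n : ℕ} (a b c d : Fin n) :
    diagOp q a b * diagOp q c d = diagOp q c d * diagOp q a b := by
  refine end_ext fun β => ?_
  simp only [Module.End.mul_apply, diagOp_mono, map_smul, smul_smul, mul_comm]

lemma diagOp_inv (q : kˣ) {n : ℕ} (a b : Fin n) : diagOp q a b * diagOp q b a = 1 := by
  refine end_ext fun β => ?_
  simp only [Module.End.mul_apply, diagOp_mono, map_smul, smul_smul, ← Units.val_mul, ← zpow_add]
  simp

/-- `K E K⁻¹ = q^r E` where `r` is the pairing of the weights `ε_a - ε_b` and `ε_c - ε_d`. -/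
lemma diagOp_conj (q : kˣ) {n : ℕ} (a b c d : Fin n) :
    diagOp q a b * moveOp q c d * diagOp q b a =
      ((q ^ (((if a = c then 1 else 0) - (if a = d then 1 else 0)
        - (if b = c then 1 else 0) + (if b = d then 1 else 0) : ℤ)) : kˣ) : k) • moveOp q c d := by
  refine end_ext fun β => ?_
  simp only [Module.End.mul_apply, LinearMap.smul_apply, diagOp_mono, map_smul]
  by_cases hd : β d = 0
  · simp [moveOp_zero q hd]
  · simp only [moveOp_pos q hd, map_smul, diagOp_mono, smul_smul]
    congr 1
    rw [mul_comm (qInt q _), ← mul_assoc, ← Units.val_mul, ← zpow_add]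
    congr 3
    simp only [shift]
    split_ifs <;> subst_vars <;> omega

lemma moveOp_comm (q : kˣ) {n : ℕ} (a b c d : Fin n) (had : a ≠ d) (hbc : b ≠ c) (hab : a ≠ b)
    (hcd : c ≠ d) : moveOp q a b * moveOp q c d = moveOp q c d * moveOp q a b := by
  refine end_ext fun β => ?_
  simp only [Module.End.mul_apply]
  by_cases hd : β d = 0
  · by_cases hb : β b = 0
    · simp [moveOp_zero q hd, moveOp_zero q hb]
    · have h1 : shift a b β d = 0 := by simp [shift, had.symm, hd]
      simp [moveOp_zero q hd, moveOp_pos q hb, moveOp_zero q h1]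
  · by_cases hb : β b = 0
    · have h1 : shift c d β b = 0 := by simp [shift, hbc, hb]
      simp [moveOp_zero q hb, moveOp_pos q hd, moveOp_zero q h1]
    · have hc : shift a b (shift c d β) = shift c d (shift a b β) := by
        ext t; simp only [shift]; split_ifs <;> subst_vars <;> omega
      have hbd : shift c d β b = 0 ↔ shift a b β d = 0 := by
        by_cases h : b = d
        · subst h; rw [shift_tgt hcd, shift_tgt hab]
        · rw [shift_of_ne hbc h, shift_of_ne had.symm (Ne.symm h)]; simp [hb, hd]
      simp only [moveOp_pos q hb, moveOp_pos q hd, map_smul]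
      by_cases h0 : shift c d β b = 0
      · rw [moveOp_zero q h0, moveOp_zero q (hbd.1 h0)]; simp
      · rw [moveOp_pos q h0, moveOp_pos q (fun h => h0 (hbd.2 h)), hc, smul_smul, smul_smul]
        congr 1
        by_cases hac : a = c
        · subst hac; rw [shift_src hab, shift_src hcd]
        · rw [shift_of_ne hac had, shift_of_ne (Ne.symm hac) hbc.symm, mul_comm]

lemma moveOp_back (q : kˣ) {n : ℕ} {a b : Fin n} (hab : a ≠ b) (β : Fin n → ℕ) :
    moveOp q a b (moveOp q b a (mono k β)) = (qInt q (β a) * qInt q (β b + 1)) • mono k β := by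
  by_cases ha : β a = 0
  · simp [moveOp_zero q ha, ha, qInt_zero]
  · have h1 : shift b a β b ≠ 0 := by rw [shift_src hab.symm]; omega
    have h2 : shift a b (shift b a β) = β := by
      ext t; simp only [shift]; split_ifs <;> subst_vars <;> omega
    rw [moveOp_pos q ha, map_smul, moveOp_pos q h1, h2, smul_smul, shift_tgt hab.symm,
      Nat.sub_add_cancel (Nat.one_le_iff_ne_zero.mpr ha), mul_comm]

lemma moveOp_bracket (q : kˣ) {n : ℕ} (a b : Fin n) (hab : a ≠ b) :
    ((q : k) - ((q⁻¹ : kˣ) : k)) • (moveOp q a b * moveOp q b a - moveOp q b a * moveOp q a b)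
      = diagOp q a b - diagOp q b a := by
  refine end_ext fun β => ?_
  simp only [LinearMap.smul_apply, LinearMap.sub_apply, Module.End.mul_apply, diagOp_mono,
    moveOp_back q hab, moveOp_back q hab.symm]
  rw [← sub_smul, ← sub_smul, ← qInt_cross, smul_smul]
  congr 2
  ring

lemma moveOp_serre (q : kˣ) {n : ℕ} (a b c : Fin n) (hab : a ≠ b) (hbc : b ≠ c) (hac : a ≠ c) :
    moveOp q a b * moveOp q a b * moveOp q b c
      - qInt q 2 • (moveOp q a b * moveOp q b c * moveOp q a b)
      + moveOp q b c * moveOp q a b * moveOp q a b = 0 := by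
  refine end_ext fun β => ?_
  simp only [LinearMap.smul_apply, LinearMap.sub_apply, LinearMap.add_apply, Module.End.mul_apply,
    LinearMap.zero_apply]
  have hsa := fun γ : Fin n → ℕ => shift_src hab γ
  have hsb := fun γ : Fin n → ℕ => shift_tgt hab γ
  have hsc := fun γ : Fin n → ℕ => shift_of_ne hac.symm hbc.symm γ
  have hta := fun γ : Fin n → ℕ => shift_of_ne hab hac γ
  have htb := fun γ : Fin n → ℕ => shift_src hbc γ
  have htc := fun γ : Fin n → ℕ => shift_tgt hbc γ
  by_cases hc : β c = 0
  · by_cases hb : β b = 0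
    · simp [moveOp_zero q hc, moveOp_zero q hb]
    · rw [moveOp_zero q hc, moveOp_pos q hb]
      have h1 : shift a b β c = 0 := by rw [hsc, hc]
      by_cases hb' : shift a b β b = 0
      · simp [moveOp_zero q h1, moveOp_zero q hb']
      · have h2 : shift a b (shift a b β) c = 0 := by rw [hsc, h1]
        simp [moveOp_zero q h1, moveOp_pos q hb', moveOp_zero q h2]
  by_cases hb : β b = 0
  · have h1 : shift b c β b ≠ 0 := by rw [htb]; omega
    have h2 : shift a b (shift b c β) b = 0 := by rw [hsb, htb, hb]
    simp [moveOp_zero q hb, moveOp_pos q hc, moveOp_pos q h1, moveOp_zero q h2]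
  obtain ⟨d, hd⟩ := Nat.exists_eq_succ_of_ne_zero hb
  have e1 : shift a b (shift b c (shift a b β)) = shift a b (shift a b (shift b c β)) := by
    ext t; simp only [shift]; split_ifs <;> subst_vars <;> omega
  have T1 : moveOp q a b (moveOp q a b (moveOp q b c (mono k β)))
      = (qInt q (d + 2) * qInt q (β a + 1) * qInt q (β a + 2)) •
        mono k (shift a b (shift a b (shift b c β))) := by
    have h1 : shift b c β b ≠ 0 := by rw [htb]; omega
    have h2 : shift a b (shift b c β) b ≠ 0 := by rw [hsb, htb]; omega
    rw [moveOp_pos q hc, map_smul, moveOp_pos q h1, map_smul, map_smul, moveOp_pos q h2,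
      smul_smul, smul_smul, hsa, hta, hd, mul_assoc]
  have T2 : moveOp q a b (moveOp q b c (moveOp q a b (mono k β)))
      = (qInt q (β a + 1) * qInt q (d + 1) * qInt q (β a + 2)) •
        mono k (shift a b (shift a b (shift b c β))) := by
    have h1 : shift a b β c ≠ 0 := by rwa [hsc]
    have h2 : shift b c (shift a b β) b ≠ 0 := by rw [htb]; omega
    rw [moveOp_pos q hb, map_smul, moveOp_pos q h1, map_smul, map_smul, moveOp_pos q h2,
      smul_smul, smul_smul, hta, hsa, hsb, hd, e1, mul_assoc, Nat.succ_sub_one, mul_assoc]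
  have T3 : moveOp q b c (moveOp q a b (moveOp q a b (mono k β)))
      = (qInt q (β a + 1) * qInt q (β a + 2) * qInt q d) •
        mono k (shift a b (shift a b (shift b c β))) := by
    by_cases hd0 : d = 0
    · have h1 : shift a b β b = 0 := by rw [hsb]; omega
      simp [moveOp_pos q hb, moveOp_zero q h1, hd0, qInt_zero]
    · have h1 : shift a b β b ≠ 0 := by rw [hsb]; omega
      have h2 : shift a b (shift a b β) c ≠ 0 := by rwa [hsc, hsc]
      have e2 : shift b c (shift a b (shift a b β)) = shift a b (shift a b (shift b c β)) := by
        ext t; simp only [shift]; split_ifs <;> subst_vars <;> omega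
      have h3 : shift a b (shift a b β) b + 1 = d := by rw [hsb, hsb]; omega
      rw [moveOp_pos q hb, map_smul, moveOp_pos q h1, map_smul, map_smul, moveOp_pos q h2,
        smul_smul, smul_smul, hsa, h3, e2, mul_assoc]
  rw [T1, T2, T3, smul_smul, ← sub_smul, ← add_smul]
  convert zero_smul k _ using 2
  linear_combination (qInt q (β a + 1) * qInt q (β a + 2)) * qInt_serre q d

lemma moveOp_serre' (q : kˣ) {n : ℕ} (a b c : Fin n) (hab : a ≠ b) (hbc : b ≠ c) (hac : a ≠ c) :
    moveOp q b c * moveOp q b c * moveOp q a b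
      - qInt q 2 • (moveOp q b c * moveOp q a b * moveOp q b c)
      + moveOp q a b * moveOp q b c * moveOp q b c = 0 := by
  refine end_ext fun β => ?_
  simp only [LinearMap.smul_apply, LinearMap.sub_apply, LinearMap.add_apply, Module.End.mul_apply,
    LinearMap.zero_apply]
  have hsa := fun γ : Fin n → ℕ => shift_src hab γ
  have hsb := fun γ : Fin n → ℕ => shift_tgt hab γ
  have hsc := fun γ : Fin n → ℕ => shift_of_ne hac.symm hbc.symm γ
  have hta := fun γ : Fin n → ℕ => shift_of_ne hab hac γ
  have htb := fun γ : Fin n → ℕ => shift_src hbc γ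
  have htc := fun γ : Fin n → ℕ => shift_tgt hbc γ
  have e2 : shift a b (shift b c (shift b c β)) = shift b c (shift a b (shift b c β)) := by
    ext t; simp only [shift]; split_ifs <;> subst_vars <;> omega
  have T2 : moveOp q b c (moveOp q a b (moveOp q b c (mono k β)))
      = (qInt q (β b + 1) * qInt q (β a + 1) * (if β c ≤ 1 then 0 else qInt q (β b + 1))) •
        mono k (shift b c (shift a b (shift b c β))) := by
    by_cases hc : β c = 0
    · simp [moveOp_zero q hc, hc]
    have h1 : shift b c β b ≠ 0 := by rw [htb]; omega
    rw [moveOp_pos q hc, map_smul, moveOp_pos q h1, map_smul, map_smul]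
    by_cases hc1 : β c ≤ 1
    · have h2 : shift a b (shift b c β) c = 0 := by rw [hsc, htc]; omega
      simp [moveOp_zero q h2, hc1]
    · have h2 : shift a b (shift b c β) c ≠ 0 := by rw [hsc, htc]; omega
      rw [moveOp_pos q h2, smul_smul, smul_smul, hta, hsb, htb, if_neg hc1, mul_assoc,
        Nat.add_sub_cancel, mul_assoc]
  have T3 : moveOp q a b (moveOp q b c (moveOp q b c (mono k β)))
      = (qInt q (β b + 1) * (if β c ≤ 1 then 0 else qInt q (β b + 2)) * qInt q (β a + 1)) •
        mono k (shift b c (shift a b (shift b c β))) := by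
    by_cases hc : β c = 0
    · simp [moveOp_zero q hc, hc]
    rw [moveOp_pos q hc, map_smul]
    by_cases hc1 : β c ≤ 1
    · have h2 : shift b c β c = 0 := by rw [htc]; omega
      simp [moveOp_zero q h2, hc1]
    · have h2 : shift b c β c ≠ 0 := by rw [htc]; omega
      have h3 : shift b c (shift b c β) b ≠ 0 := by rw [htb]; omega
      rw [moveOp_pos q h2, map_smul, map_smul, moveOp_pos q h3, smul_smul, smul_smul,
        hta, hta, htb, if_neg hc1, e2, mul_assoc]
  have T1 : moveOp q b c (moveOp q b c (moveOp q a b (mono k β)))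
      = (qInt q (β a + 1) * qInt q (β b) * (if β c ≤ 1 then 0 else qInt q (β b + 1))) •
        mono k (shift b c (shift a b (shift b c β))) := by
    by_cases hb : β b = 0
    · simp [moveOp_zero q hb, hb, qInt_zero]
    rw [moveOp_pos q hb, map_smul, map_smul]
    by_cases hc : β c = 0
    · have h1 : shift a b β c = 0 := by rw [hsc, hc]
      simp [moveOp_zero q h1, hc]
    have h1 : shift a b β c ≠ 0 := by rwa [hsc]
    have e1 : shift b c (shift b c (shift a b β)) = shift b c (shift a b (shift b c β)) := by
      ext t; simp only [shift]; split_ifs <;> subst_vars <;> omega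
    rw [moveOp_pos q h1, map_smul]
    by_cases hc1 : β c ≤ 1
    · have h2 : shift b c (shift a b β) c = 0 := by rw [htc, hsc]; omega
      simp [moveOp_zero q h2, hc1]
    · have h2 : shift b c (shift a b β) c ≠ 0 := by rw [htc, hsc]; omega
      have h3 : shift a b β b + 1 = β b := by rw [hsb]; omega
      rw [moveOp_pos q h2, smul_smul, smul_smul, htb, h3, if_neg hc1, e1, mul_assoc]
  rw [T1, T2, T3, smul_smul, ← sub_smul, ← add_smul]
  convert zero_smul k _ using 2
  split_ifs
  · ring
  · linear_combination (qInt q (β a + 1) * qInt q (β b + 1)) * qInt_serre q (β b)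

lemma moveOp_pow (q : kˣ) {n : ℕ} {a b : Fin n} (hab : a ≠ b) (p : ℕ) (β : Fin n → ℕ) :
    ∃ y, (moveOp q a b ^ p) (mono k β) = (∏ t ∈ range p, qInt q (β a + 1 + t)) • y := by
  induction p generalizing β with
  | zero => exact ⟨mono k β, by simp⟩
  | succ p ih =>
    rw [pow_succ, Module.End.mul_apply]
    by_cases hb : β b = 0
    · exact ⟨0, by simp [moveOp_zero q hb]⟩
    · obtain ⟨y, hy⟩ := ih (shift a b β)
      refine ⟨y, ?_⟩
      rw [moveOp_pos q hb, map_smul, hy, smul_smul, prod_range_succ', mul_comm, shift_src hab]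
      congr 2
      refine prod_congr rfl fun t _ => ?_
      congr 1
      omega

lemma moveOp_pow_qChar (q : kˣ) {n : ℕ} {a b : Fin n} (hab : a ≠ b) (h : 0 < qChar q) :
    moveOp q a b ^ qChar q = 0 := by
  refine end_ext fun β => ?_
  obtain ⟨y, hy⟩ := moveOp_pow q hab (qChar q) β
  rw [hy, prod_eq_zero (i := qChar q - 1 - β a % qChar q), zero_smul, LinearMap.zero_apply]
  · rw [mem_range]; omega
  · have h1 := Nat.mod_lt (β a) h
    have h2 := Nat.div_add_mod (β a) (qChar q)
    have h3 : β a + 1 + (qChar q - 1 - β a % qChar q) = (β a / qChar q + 1) * qChar q := by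
      rw [add_mul, one_mul, mul_comm]; omega
    rw [h3, qInt_mul_qChar]

lemma diagOp_pow_qChar (q : kˣ) {n : ℕ} (a b : Fin n) : diagOp q a b ^ (2 * qChar q) = 1 := by
  refine end_ext fun β => ?_
  have h : ∀ p : ℕ, (diagOp q a b ^ p) (mono k β)
      = ((q ^ ((β a : ℤ) - (β b : ℤ)) : kˣ) : k) ^ p • mono k β := by
    intro p
    induction p with
    | zero => simp
    | succ p ih => rw [pow_succ', Module.End.mul_apply, ih, map_smul, diagOp_mono, smul_smul,
        pow_succ]
  rw [h, ← Units.val_pow_eq_pow_val, ← zpow_natCast, ← zpow_mul, mul_comm, zpow_mul,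
    Nat.cast_mul, Nat.cast_two, q_pow_two_qChar, one_zpow, Units.val_one, one_smul,
    Module.End.one_apply]

/-- The action of the free algebra. -/
def freeRep (q : kˣ) (n : ℕ) : FreeAlgebra k (Gen n) →ₐ[k] Module.End k (DivPow k n) :=
  FreeAlgebra.lift k (genOp q)

lemma cartan_eq_zero {n : ℕ} {i j : Fin (n - 1)} (h : cartan i j = 0) :
    i ≠ j ∧ i.val + 1 ≠ j.val ∧ j.val + 1 ≠ i.val := by
  unfold cartan at h
  by_cases h1 : i = j
  · simp [h1] at h
  · by_cases h2 : i.val + 1 = j.val ∨ j.val + 1 = i.val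
    · simp [h1, h2] at h
    · exact ⟨h1, by omega, by omega⟩

lemma cartan_eq_neg_one {n : ℕ} {i j : Fin (n - 1)} (h : cartan i j = -1) :
    i.val + 1 = j.val ∨ j.val + 1 = i.val := by
  unfold cartan at h
  split_ifs at h with h1 h2
  exact h2

lemma cartan_eq {n : ℕ} (i j : Fin (n - 1)) :
    cartan i j = (if lo i = lo j then 1 else 0) - (if lo i = hi j then 1 else 0)
        - (if hi i = lo j then 1 else 0) + (if hi i = hi j then 1 else 0) := by
  simp only [cartan, lo, hi, Fin.ext_iff]
  split_ifs <;> omega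

lemma freeRep_rel (q : kˣ) (n : ℕ) ⦃x y : FreeAlgebra k (Gen n)⦄ (h : URel q n x y) :
    freeRep q n x = freeRep q n y := by
  cases h with
  | K_mul_Kinv i => simp [freeRep, genOp, diagOp_inv]
  | Kinv_mul_K i => simp [freeRep, genOp, diagOp_inv]
  | K_comm i j => simp [freeRep, genOp, diagOp_comm q (lo i)]
  | K_e i j => simp [freeRep, genOp, diagOp_conj, cartan_eq]
  | K_f i j =>
    simp only [freeRep, map_mul, map_smul, FreeAlgebra.lift_ι_apply, genOp, diagOp_conj]
    congr 4
    rw [cartan_eq]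
    ring
  | e_f i j =>
    by_cases hij : i = j
    · subst hij
      simp only [freeRep, if_true, map_mul, map_smul, map_sub, FreeAlgebra.lift_ι_apply, genOp]
      exact moveOp_bracket q _ _ (lo_ne_hi i)
    · simp only [freeRep, hij, if_false, map_mul, map_smul, map_sub, map_zero,
        FreeAlgebra.lift_ι_apply, genOp]
      rw [moveOp_comm q (lo i) (hi i) (hi j) (lo j), sub_self, smul_zero]
      · simpa [lo, Fin.ext_iff] using hij
      · simpa [hi, Fin.ext_iff] using hij
      · exact lo_ne_hi i
      · exact (lo_ne_hi j).symm
  | e_comm i j h =>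
    obtain ⟨h1, h2, h3⟩ := cartan_eq_zero h
    simp only [freeRep, map_mul, FreeAlgebra.lift_ι_apply, genOp]
    apply moveOp_comm <;> simp only [lo, hi, ne_eq, Fin.ext_iff] <;> omega
  | f_comm i j h =>
    obtain ⟨h1, h2, h3⟩ := cartan_eq_zero h
    simp only [freeRep, map_mul, FreeAlgebra.lift_ι_apply, genOp]
    apply moveOp_comm <;> simp only [lo, hi, ne_eq, Fin.ext_iff] <;> omega
  | e_serre i j h =>
    simp only [freeRep, map_mul, map_smul, map_sub, map_add, map_zero, FreeAlgebra.lift_ι_apply,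
      genOp]
    rcases cartan_eq_neg_one h with h | h
    · have e : lo j = hi i := by simp [lo, hi, h]
      rw [e]
      apply moveOp_serre <;> simp only [lo, hi, ne_eq, Fin.ext_iff] <;> omega
    · have e : lo i = hi j := by simp [lo, hi, h]
      rw [e]
      apply moveOp_serre' <;> simp only [lo, hi, ne_eq, Fin.ext_iff] <;> omega
  | f_serre i j h =>
    simp only [freeRep, map_mul, map_smul, map_sub, map_add, map_zero, FreeAlgebra.lift_ι_apply,
      genOp]
    rcases cartan_eq_neg_one h with h | h
    · have e : lo j = hi i := by simp [lo, hi, h]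
      rw [e]
      apply moveOp_serre' <;> simp only [lo, hi, ne_eq, Fin.ext_iff] <;> omega
    · have e : lo i = hi j := by simp [lo, hi, h]
      rw [e]
      apply moveOp_serre <;> simp only [lo, hi, ne_eq, Fin.ext_iff] <;> omega

/-- The action of `U_q(sl_n)` on `A_q(n)`. -/
def bigRep (q : kˣ) (n : ℕ) : BigU q n →ₐ[k] Module.End k (DivPow k n) :=
  RingQuot.liftAlgHom k ⟨freeRep q n, freeRep_rel q n⟩

lemma bigRep_genU (q : kˣ) {n : ℕ} (g : Gen n) : bigRep q n (genU q g) = genOp q g :=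
  (RingQuot.liftAlgHom_mkAlgHom_apply k (freeRep q n) (freeRep_rel q n) (gen k g)).trans
    (FreeAlgebra.lift_ι_apply _ _)

lemma bigRep_rel (q : kˣ) (n : ℕ) ⦃x y : BigU q n⦄ (h : uRel q n x y) :
    bigRep q n x = bigRep q n y := by
  cases h with
  | e_pow i h =>
    rw [map_pow, bigRep_genU, map_zero]
    exact moveOp_pow_qChar q (lo_ne_hi i) h
  | f_pow i h =>
    rw [map_pow, bigRep_genU, map_zero]
    exact moveOp_pow_qChar q (lo_ne_hi i).symm h
  | K_pow i h =>
    rw [map_pow, bigRep_genU, map_one]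
    exact diagOp_pow_qChar q _ _

/-- The action of `u_q(sl_n)` on `A_q(n)`. -/
def smallRep (q : kˣ) (n : ℕ) : SmallU q n →ₐ[k] Module.End k (DivPow k n) :=
  RingQuot.liftAlgHom k ⟨bigRep q n, bigRep_rel q n⟩

lemma smallRep_genu (q : kˣ) {n : ℕ} (g : Gen n) : smallRep q n (genu q g) = genOp q g :=
  (RingQuot.liftAlgHom_mkAlgHom_apply k (bigRep q n) (bigRep_rel q n) (genU q g)).trans
    (bigRep_genU q g)

/-- `A_q(n)` as a module over `u_q(sl_n)`. -/
instance instModule (q : kˣ) (n : ℕ) : Module (SmallU q n) (DivPow k n) :=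
  Module.compHom (DivPow k n) (smallRep q n).toRingHom

lemma smul_def (q : kˣ) {n : ℕ} (u : SmallU q n) (y : DivPow k n) :
    u • y = smallRep q n u y := rfl

lemma genu_smul (q : kˣ) {n : ℕ} (g : Gen n) (y : DivPow k n) :
    genu q g • y = genOp q g y := by
  rw [smul_def, smallRep_genu]

instance instTower (q : kˣ) (n : ℕ) : IsScalarTower k (SmallU q n) (DivPow k n) :=
  ⟨fun c u y => by rw [smul_def, smul_def, map_smul, LinearMap.smul_apply]⟩

/-- A subspace stable under the generators is stable under `u_q(sl_n)`. -/
lemma smul_mem_of_gen (q : kˣ) {n : ℕ} (W : Submodule k (DivPow k n))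
    (hW : ∀ g : Gen n, ∀ y ∈ W, genOp q g y ∈ W) (u : SmallU q n) :
    ∀ y ∈ W, u • y ∈ W := by
  obtain ⟨v, rfl⟩ : ∃ v, mku q n v = u := RingQuot.mkAlgHom_surjective k (uRel q n) u
  obtain ⟨w, rfl⟩ : ∃ w, mkU q n w = v := RingQuot.mkAlgHom_surjective k (URel q n) v
  induction w using FreeAlgebra.induction with
  | grade0 r =>
    intro y hy
    rw [AlgHom.commutes, AlgHom.commutes, algebraMap_smul]
    exact W.smul_mem r hy
  | grade1 g =>
    intro y hy
    have h := genu_smul q g y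
    rw [genu, genU] at h
    rw [h]
    exact hW g y hy
  | mul a b ha hb =>
    intro y hy
    rw [map_mul, map_mul, mul_smul]
    exact ha _ (hb _ hy)
  | add a b ha hb =>
    intro y hy
    rw [map_add, map_add, add_smul]
    exact W.add_mem (ha _ hy) (hb _ hy)

/-! ### Truncated homogeneous components -/

/-- The index set `ℤ_+^n(s, 𝐦)`: the `α ∈ ℕ^n` with `|α| = s` and all `α_i ≤ mℓ - 1`, where `ℓ` is
the characteristic of `q`. -/
def index (q : kˣ) (n m s : ℕ) : Set (Fin n → ℕ) :=
  {α | ∑ i, α i = s ∧ ∀ i, α i < m * qChar q}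

lemma sum_shift {n : ℕ} {a b : Fin n} (hab : a ≠ b) (β : Fin n → ℕ) (hb : β b ≠ 0) :
    ∑ t, shift a b β t = ∑ t, β t := by
  have h : ∑ t, (shift a b β t + if t = b then 1 else 0)
      = ∑ t, (β t + if t = a then 1 else 0) := by
    refine sum_congr rfl fun t _ => ?_
    simp only [shift]
    split_ifs <;> subst_vars <;> omega
  rw [sum_add_distrib, sum_add_distrib] at h
  simpa using h

lemma moveOp_mem_span (q : kˣ) {n m s : ℕ} {a b : Fin n} (hab : a ≠ b) {β : Fin n → ℕ}
    (hβ : β ∈ index q n m s) :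
    moveOp q a b (mono k β) ∈ Submodule.span k (mono k '' index q n m s) := by
  by_cases hb : β b = 0
  · rw [moveOp_zero q hb]; exact Submodule.zero_mem _
  rw [moveOp_pos q hb]
  by_cases ha : β a + 1 = m * qChar q
  · rw [ha, qInt_mul_qChar, zero_smul]; exact Submodule.zero_mem _
  refine Submodule.smul_mem _ _ (Submodule.subset_span ⟨_, ⟨?_, fun t => ?_⟩, rfl⟩)
  · rw [sum_shift hab β hb]; exact hβ.1
  · have h1 := hβ.2 t
    have h2 := hβ.2 a
    simp only [shift]
    split_ifs <;> subst_vars <;> omega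

lemma diagOp_mem_span (q : kˣ) {n m s : ℕ} (a b : Fin n) {β : Fin n → ℕ}
    (hβ : β ∈ index q n m s) :
    diagOp q a b (mono k β) ∈ Submodule.span k (mono k '' index q n m s) := by
  rw [diagOp_mono]
  exact Submodule.smul_mem _ _ (Submodule.subset_span ⟨_, hβ, rfl⟩)

/-- The homogeneous component `A_q^{(s)}(n, 𝐦)`, the `k`-span of the `x^(α)` with
`α ∈ ℤ_+^n(s, 𝐦)`, as a `u_q(sl_n)`-submodule of `A_q(n)`. -/
def homog (q : kˣ) (n m s : ℕ) : Submodule (SmallU q n) (DivPow k n) :=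
  { Submodule.span k (mono k '' index q n m s) with
    smul_mem' := by
      intro u y hy
      refine smul_mem_of_gen q (Submodule.span k (mono k '' index q n m s)) ?_ u y hy
      intro g
      suffices h : Submodule.span k (mono k '' index q n m s)
          ≤ (Submodule.span k (mono k '' index q n m s)).comap (genOp q g) from fun y hy => h hy
      rw [Submodule.span_le]
      rintro _ ⟨β, hβ, rfl⟩
      cases g with
      | e i => exact moveOp_mem_span q (lo_ne_hi i) hβ
      | f i => exact moveOp_mem_span q (lo_ne_hi i).symm hβ
      | K i => exact diagOp_mem_span q _ _ hβ
      | Kinv i => exact diagOp_mem_span q _ _ hβ }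

/-! ### Energy degrees -/

/-- The energy degree `|𝓔(α)| = ∑ ⌊α_i / ℓ⌋` of the monomial `x^(α)`. -/
def energy (q : kˣ) {n : ℕ} (α : Fin n → ℕ) : ℕ := ∑ i, α i / qChar q

/-- The energy degree of an element: the largest energy degree of a monomial that occurs in it. -/
def edeg (q : kˣ) {n : ℕ} (y : DivPow k n) : ℕ := y.support.sup (energy q)

/-- `E(s)_0`, the lowest energy degree of the non-zero elements of `A_q^{(s)}(n, 𝐦)`. -/
def minEnergy (q : kˣ) (n m s : ℕ) : ℕ :=
  sInf {e | ∃ y ∈ homog q n m s, y ≠ 0 ∧ edeg q y = e}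

/-- `E(s)`, the highest energy degree of the non-zero elements of `A_q^{(s)}(n, 𝐦)`. -/
def maxEnergy (q : kˣ) (n m s : ℕ) : ℕ :=
  sSup {e | ∃ y ∈ homog q n m s, y ≠ 0 ∧ edeg q y = e}

/-! ### Module-theoretic notions -/

/-- The socle of a module: the sum of its simple submodules. -/
def socle (R M : Type*) [Ring R] [AddCommGroup M] [Module R M] : Submodule R M :=
  sSup {S : Submodule R M | IsSimpleModule R S}

/-- A module is indecomposable if it is non-zero and not the direct sum of two non-zero
submodules. -/
def IsIndecomposable (R M : Type*) [Ring R] [AddCommGroup M] [Module R M] : Prop :=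
  Nontrivial M ∧ ∀ A B : Submodule R M, IsCompl A B → A = ⊥ ∨ B = ⊥

/-- The socle of `A_q^{(s)}(n, 𝐦)`, regarded as a submodule of `A_q(n)`. -/
def soc (q : kˣ) (n m s : ℕ) : Submodule (SmallU q n) (DivPow k n) :=
  (socle (SmallU q n) (homog q n m s)).map (homog q n m s).subtype

/-- The cyclic submodule `u_q(sl_n) · y`. -/
def cyclic (q : kˣ) {n : ℕ} (y : DivPow k n) : Submodule (SmallU q n) (DivPow k n) :=
  Submodule.span (SmallU q n) {y}

/-- `v` is a highest weight vector of the submodule `V`: a non-zero vector that generates `V`, is an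
eigenvector of every `K_i` and is annihilated by every `e_i`. -/
def IsHighestWeightVector (q : kˣ) {n : ℕ} (V : Submodule (SmallU q n) (DivPow k n))
    (v : DivPow k n) : Prop :=
  v ≠ 0 ∧ cyclic q v = V ∧ (∀ i, genu q (Gen.e i : Gen n) • v = 0) ∧
    ∀ i, ∃ c : k, genu q (Gen.K i : Gen n) • v = c • v

/-! ### The exponents of the highest weight vectors -/

/-- `(s, 0, …, 0)`. -/
def etaLow (n s : ℕ) : Fin n → ℕ := fun i => if i.val = 0 then s else 0

/-- `(ℓ-1, …, ℓ-1, h, 0, …, 0)` with `j` entries `ℓ - 1`. -/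
def etaMid (n l j h : ℕ) : Fin n → ℕ := fun i =>
  if i.val < j then l - 1 else if i.val = j then h else 0

/-- `(κ_1 ℓ + (ℓ-1), …, κ_{n-1} ℓ + (ℓ-1), κ_n ℓ + h)`. -/
def etaHigh {n : ℕ} (l h : ℕ) (κ : Fin n → ℕ) : Fin n → ℕ := fun i =>
  κ i * l + if i.val + 1 = n then h else l - 1

end

end QDP

/-!
Fix `ℓ = char q` and write an exponent as `α = κ ℓ + ρ` with quotients `κ` and remainders
`0 ≤ ρ_i < ℓ`. The generators `e_i`, `f_i` move one unit between neighbouring positions: `x^(α)` is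
sent to a multiple of `x^(α + ε_a - ε_b)`, and the coefficient `[α_a + 1]` vanishes exactly if
`ρ_a = ℓ - 1` (`qInt_eq_zero_iff`). A move that does not vanish preserves `κ` if `ρ_b > 0`, and
lowers `κ_b` by one if `ρ_b = 0`; hence the energy `|κ|` never increases. Moreover each of these
operators is injective on the monomials that it does not annihilate, so a vector is annihilated by
all `e_i` if and only if each of its monomials is. This replaces all weight considerations, which
are of no use here because different monomials may have the same weight.

* The remainders of a given degree are all connected by moves (`connected`): each of them can be
  moved to the only one annihilated by all `e_i`, which is `(ℓ-1, …, ℓ-1, h, 0, …, 0)`. So monomials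
  with the same quotients generate each other, and a monomial of minimal energy generates a simple
  module (`isSimpleModule_cyclic_mono`).
* If the energy of a monomial is not minimal, there is enough room in its remainders to move them to
  a position from which the energy drops at any prescribed `κ_j > 0` (`exists_descent`). Applied to
  a vector of least energy in a submodule, this shows that every non-zero submodule contains a
  combination of monomials of minimal energy (`exists_mem_bottom`), which determines the socle.
  Read backwards, it shows that the monomials of maximal energy generate.
* For the indecomposability, an endomorphism `T` acts on the span of the monomials of minimal energy
  by a scalar (`IsIntertwiner.exists_scalar`). Its matrix entries between quotients `κ` and `μ` of
  minimal energy agree up to units with those between `κ + ε_j` and `μ + ε_j` one energy level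
  higher, where an entry is zero if `κ_j = 0 < μ_j` or if an entry of `μ` is out of range. Moving up
  and down between the two levels kills the entries with `κ ≠ μ` and identifies those with `κ = μ`.
  As all non-zero submodules meet that span, the module has no proper direct summand.
-/

namespace QDP

open Finset

variable {k : Type*} [Field k]

/-! ### Vanishing of quantum integers -/

lemma qInt_eq_zero_iff {q : kˣ} (hq : 0 < qChar q) (r : ℕ) : qInt q r = 0 ↔ qChar q ∣ r := by
  have hmul : ∀ c d : ℕ, qInt q (c * qChar q + d) = 0 ↔ qInt q d = 0 := by
    intro c d
    rw [qInt_add, qInt_mul_qChar, mul_zero, zero_add, mul_eq_zero, or_iff_right (Units.ne_zero _)]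
  have h := hmul (r / qChar q) (r % qChar q)
  rw [mul_comm, Nat.div_add_mod] at h
  rw [h]
  constructor
  · intro h0
    by_contra hd
    have h1 : 0 < r % qChar q := Nat.pos_of_ne_zero fun h => hd (Nat.dvd_of_mod_eq_zero h)
    have h2 : qChar q ≤ r % qChar q := Nat.sInf_le ⟨h1, h0⟩
    exact absurd (Nat.mod_lt r hq) (not_lt.2 h2)
  · intro hd
    rw [Nat.mod_eq_zero_of_dvd hd, qInt_zero]

/-! ### Exponents: adjacent moves, quotients and remainders -/

/-- The positions `a` and `b` differ by one, so that `moveOp q a b` is the action of some `e_i` or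
`f_i`. -/
def Adj {n : ℕ} (a b : Fin n) : Prop := a.val + 1 = b.val ∨ b.val + 1 = a.val

lemma Adj.ne {n : ℕ} {a b : Fin n} (h : Adj a b) : a ≠ b := by
  rintro rfl
  rcases h with h | h <;> omega

lemma Adj.symm {n : ℕ} {a b : Fin n} (h : Adj a b) : Adj b a := Or.symm h

lemma exists_adj {n : ℕ} (hn : 2 ≤ n) (j : Fin n) : ∃ i : Fin n, Adj i j := by
  by_cases h : j.val = 0
  · exact ⟨⟨1, by omega⟩, Or.inr (by simp [h])⟩
  · exact ⟨⟨j.val - 1, by omega⟩, Or.inl (by simp; omega)⟩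

/-- The exponent `κ ℓ + ρ`. -/
def comb {n : ℕ} (l : ℕ) (κ ρ : Fin n → ℕ) : Fin n → ℕ := fun t => κ t * l + ρ t

/-- The exponent `κ + ε_j`. -/
def bump {n : ℕ} (j : Fin n) (κ : Fin n → ℕ) : Fin n → ℕ := fun t => κ t + if t = j then 1 else 0

lemma bump_same {n : ℕ} (j : Fin n) (κ : Fin n → ℕ) : bump j κ j = κ j + 1 := by simp [bump]

lemma bump_of_ne {n : ℕ} {j t : Fin n} (h : t ≠ j) (κ : Fin n → ℕ) : bump j κ t = κ t := by
  simp [bump, h]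

lemma sum_bump {n : ℕ} (j : Fin n) (κ : Fin n → ℕ) : ∑ t, bump j κ t = ∑ t, κ t + 1 := by
  simp [bump, sum_add_distrib]

lemma exists_bump {n : ℕ} {j : Fin n} {κ : Fin n → ℕ} (h : κ j ≠ 0) : ∃ κ', κ = bump j κ' := by
  refine ⟨fun t => κ t - if t = j then 1 else 0, funext fun t => ?_⟩
  simp only [bump]
  split_ifs with h1
  · subst h1; omega
  · omega

lemma bump_shift {n : ℕ} {i j : Fin n} (hij : i ≠ j) {κ : Fin n → ℕ} (hj : κ j ≠ 0) :
    bump j (shift i j κ) = bump i κ := by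
  funext t
  simp only [bump, shift]
  split_ifs <;> subst_vars <;> omega

lemma shift_injective {n : ℕ} {a b : Fin n} {β γ : Fin n → ℕ} (hβ : β b ≠ 0) (hγ : γ b ≠ 0)
    (h : shift a b β = shift a b γ) : β = γ := by
  funext t
  have := congrFun h t
  simp only [shift] at this
  split_ifs at this <;> subst_vars <;> omega

section comb

variable {n l : ℕ} {κ ρ κ' ρ' : Fin n → ℕ}

lemma comb_div (hρ : ∀ t, ρ t < l) (t : Fin n) : comb l κ ρ t / l = κ t := by
  have := hρ t
  rw [comb, mul_comm, Nat.mul_add_div (by omega), Nat.div_eq_of_lt this, add_zero]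

lemma comb_mod (hρ : ∀ t, ρ t < l) (t : Fin n) : comb l κ ρ t % l = ρ t := by
  rw [comb, mul_comm, Nat.mul_add_mod, Nat.mod_eq_of_lt (hρ t)]

lemma comb_div_mod (l : ℕ) (α : Fin n → ℕ) :
    comb l (fun t => α t / l) (fun t => α t % l) = α :=
  funext fun _ => Nat.div_add_mod' _ _

lemma sum_comb (l : ℕ) (κ ρ : Fin n → ℕ) :
    ∑ t, comb l κ ρ t = (∑ t, κ t) * l + ∑ t, ρ t := by
  simp [comb, sum_add_distrib, sum_mul]

lemma comb_lt {m : ℕ} {t : Fin n} (hκ : κ t < m) (hρ : ρ t < l) : comb l κ ρ t < m * l := by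
  have : (κ t + 1) * l ≤ m * l := Nat.mul_le_mul_right l hκ
  simp only [comb]
  rw [add_mul] at this
  omega

/-- A move that does not change the quotients. -/
lemma shift_comb {a b : Fin n} (hb : ρ b ≠ 0) :
    shift a b (comb l κ ρ) = comb l κ (shift a b ρ) := by
  funext t
  simp only [shift, comb]
  split_ifs <;> subst_vars <;> omega

lemma shift_lt {a b : Fin n} (hρ : ∀ t, ρ t < l) (ha : ρ a + 1 < l) (t : Fin n) :
    shift a b ρ t < l := by
  have := hρ t
  simp only [shift]
  split_ifs <;> subst_vars <;> omega

lemma not_dvd_comb_succ {a : Fin n} (ha : ρ a + 1 < l) : ¬ l ∣ comb l κ ρ a + 1 := by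
  intro h
  rw [comb, add_assoc, mul_comm, Nat.dvd_add_right (Dvd.intro _ rfl)] at h
  exact absurd (Nat.le_of_dvd (by omega) h) (by omega)

end comb

/-- An exponent below given bounds and with given sum. -/
lemma exists_sum_eq {n : ℕ} (c : Fin n → ℕ) (t : ℕ) (ht : t ≤ ∑ i, c i) :
    ∃ ρ : Fin n → ℕ, (∀ i, ρ i ≤ c i) ∧ ∑ i, ρ i = t := by
  induction t with
  | zero => exact ⟨0, fun _ => Nat.zero_le _, by simp⟩
  | succ t ih =>
    obtain ⟨ρ, h1, h2⟩ := ih (by omega)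
    obtain ⟨j, -, hj⟩ := exists_lt_of_sum_lt (s := univ) (f := ρ) (g := c) (by omega)
    refine ⟨bump j ρ, fun i => ?_, by rw [sum_bump, h2]⟩
    have := h1 i
    simp only [bump]
    split_ifs <;> subst_vars <;> omega

/-- For every position `j` there is a move into a neighbour `i` that lowers the `j`-th quotient by
one and leaves the other quotients alone, provided the remainders leave enough room. -/
lemma exists_descent {n l t : ℕ} (hn : 2 ≤ n) (hl : 2 ≤ l) (ht : t + l ≤ n * (l - 1))
    (j : Fin n) : ∃ (i : Fin n) (ρ ρ' : Fin n → ℕ), Adj i j ∧ (∀ x, ρ x < l) ∧ (∀ x, ρ' x < l) ∧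
      ∑ x, ρ x = t ∧ ∑ x, ρ' x = t + l ∧ ρ j = 0 ∧ ρ i + 1 < l ∧
      ∀ κ, shift i j (comb l (bump j κ) ρ) = comb l κ ρ' := by
  obtain ⟨i, hij⟩ := exists_adj hn j
  have hne := hij.ne
  set c : Fin n → ℕ := fun x => if x = j then 0 else if x = i then l - 2 else l - 1 with hc
  have hsum : ∑ x, c x + l = n * (l - 1) := by
    have : ∑ x, (c x + ((if x = j then l - 1 else 0) + if x = i then 1 else 0))
        = ∑ _x : Fin n, (l - 1) := by
      refine sum_congr rfl fun x _ => ?_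
      simp only [hc]
      split_ifs <;> subst_vars <;> omega
    simp only [sum_add_distrib, sum_ite_eq', mem_univ, if_true, sum_const, card_univ,
      Fintype.card_fin, smul_eq_mul] at this
    omega
  obtain ⟨ρ, h1, h2⟩ := exists_sum_eq c t (by omega)
  have hj : ρ j = 0 := by have := h1 j; simp only [hc, if_true] at this; omega
  have hi : ρ i + 1 < l := by
    have := h1 i; simp only [hc, if_neg hne, if_true] at this; omega
  have hlt : ∀ x, ρ x < l := fun x => by
    have := h1 x; simp only [hc] at this; split_ifs at this <;> omega
  have hρ' : ∀ x, ρ x + ((if x = j then l - 1 else 0) + if x = i then 1 else 0) < l := by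
    intro x
    have := hlt x
    split_ifs <;> subst_vars <;> omega
  refine ⟨i, ρ, fun x => ρ x + ((if x = j then l - 1 else 0) + if x = i then 1 else 0), hij, hlt,
    hρ', h2, ?_, hj, hi, fun κ => funext fun x => ?_⟩
  · simp only [sum_add_distrib, sum_ite_eq', mem_univ, if_true]
    omega
  · simp only [shift, comb, bump, add_mul, ite_mul, zero_mul, one_mul]
    split_ifs <;> subst_vars <;> omega

/-! ### Connectedness of the restricted exponents of a given degree -/

/-- One adjacent move between exponents with all entries below `ℓ`. -/
def Step {n : ℕ} (l : ℕ) (ρ ρ' : Fin n → ℕ) : Prop :=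
  ∃ a b, Adj a b ∧ ρ a + 1 < l ∧ ρ b ≠ 0 ∧ ρ' = shift a b ρ

lemma Step.symm {n l : ℕ} {ρ ρ' : Fin n → ℕ} (hρ : ∀ t, ρ t < l) (h : Step l ρ ρ') :
    Step l ρ' ρ := by
  obtain ⟨a, b, hab, ha, hb, rfl⟩ := h
  have := hρ b
  refine ⟨b, a, hab.symm, ?_, ?_, funext fun t => ?_⟩
  · rw [shift_tgt hab.ne]; omega
  · rw [shift_src hab.ne]; omega
  · simp only [shift]
    split_ifs <;> subst_vars <;> omega

lemma Step.lt {n l : ℕ} {ρ ρ' : Fin n → ℕ} (hρ : ∀ t, ρ t < l) (h : Step l ρ ρ') :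
    ∀ t, ρ' t < l := by
  obtain ⟨a, b, -, ha, -, rfl⟩ := h
  exact shift_lt hρ ha

lemma Step.sum {n l : ℕ} {ρ ρ' : Fin n → ℕ} (h : Step l ρ ρ') : ∑ t, ρ' t = ∑ t, ρ t := by
  obtain ⟨a, b, hab, -, hb, rfl⟩ := h
  exact sum_shift hab.ne ρ hb

/-- The monomial `x^(α)` is annihilated by all `e_i`, where `ℓ` is the characteristic of `q`. -/
def Killed {n : ℕ} (l : ℕ) (α : Fin n → ℕ) : Prop :=
  ∀ a b : Fin n, a.val + 1 = b.val → α b = 0 ∨ l ∣ α a + 1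

/-- A potential that every `e_i` lowers by one. -/
def pot {n : ℕ} (α : Fin n → ℕ) : ℕ := ∑ t, t.val * α t

lemma pot_shift {n : ℕ} {a b : Fin n} (hab : a.val + 1 = b.val) {α : Fin n → ℕ} (hb : α b ≠ 0) :
    pot (shift a b α) + 1 = pot α := by
  have hne : a ≠ b := Adj.ne (Or.inl hab)
  have h : ∑ t : Fin n, (t.val * shift a b α t + if t = b then b.val else 0)
      = ∑ t : Fin n, (t.val * α t + if t = a then a.val else 0) := by
    refine sum_congr rfl fun t _ => ?_
    by_cases h1 : t = a
    · subst h1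
      rw [shift_src hne, if_neg hne, if_pos rfl]
      ring
    · by_cases h2 : t = b
      · subst h2
        obtain ⟨d, hd⟩ := Nat.exists_eq_succ_of_ne_zero hb
        rw [shift_tgt hne, if_neg h1, if_pos rfl, hd, Nat.succ_sub_one, Nat.mul_succ]
        omega
      · rw [shift_of_ne h1 h2, if_neg h1, if_neg h2]
  simp only [sum_add_distrib, sum_ite_eq', mem_univ, if_true] at h
  simp only [pot]
  omega

lemma exists_killed_of_lt {n l : ℕ} (ρ : Fin n → ℕ) (hρ : ∀ t, ρ t < l) :
    ∃ ρ', Relation.ReflTransGen (Step l) ρ ρ' ∧ Killed l ρ' := by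
  induction hp : pot ρ using Nat.strong_induction_on generalizing ρ with
  | _ p ih =>
    by_cases h : Killed l ρ
    · exact ⟨ρ, .refl, h⟩
    · simp only [Killed, not_forall, not_or] at h
      obtain ⟨a, b, hab, hb, ha⟩ := h
      have ha' : ρ a + 1 < l := by
        have := hρ a
        rcases Nat.lt_or_ge (ρ a + 1) l with h | h
        · exact h
        · exact absurd (dvd_of_eq (by omega)) ha
      have hs : Step l ρ (shift a b ρ) := ⟨a, b, Or.inl hab, ha', hb, rfl⟩
      have hpot := pot_shift hab hb
      obtain ⟨ρ', h1, h2⟩ := ih (pot (shift a b ρ)) (by omega) _ (hs.lt hρ) rfl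
      exact ⟨ρ', .head hs h1, h2⟩

lemma Killed.eq_zero_or {n l : ℕ} (hl : 2 ≤ l) {ρ : Fin n → ℕ} (hρ : ∀ t, ρ t < l)
    (h : Killed l ρ) {a b : Fin n} (hab : a < b) : ρ b = 0 ∨ ρ a + 1 = l := by
  obtain ⟨b, hb⟩ := b
  induction b with
  | zero => exact absurd hab (by simp [Fin.lt_def])
  | succ b ih =>
    have hstep : ∀ x y : Fin n, x.val + 1 = y.val → ρ y = 0 ∨ ρ x + 1 = l := fun x y hxy =>
      (h x y hxy).imp id fun hd => le_antisymm (hρ x) (Nat.le_of_dvd (by omega) hd)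
    rcases Nat.lt_or_ge a.val b with h1 | h1
    · rcases ih (by omega) h1 with h2 | h2
      · rcases hstep ⟨b, by omega⟩ ⟨b + 1, hb⟩ rfl with h3 | h3
        · exact Or.inl h3
        · omega
      · exact Or.inr h2
    · have : a.val = b := le_antisymm (Nat.lt_succ_iff.1 hab) h1
      exact hstep a _ (by simp [this])

/-- There is only one restricted exponent of each degree that is annihilated by all `e_i`, namely
`(ℓ-1, …, ℓ-1, h, 0, …, 0)`. -/
lemma Killed.unique {n l : ℕ} (hl : 2 ≤ l) {ρ ρ' : Fin n → ℕ} (hρ : ∀ t, ρ t < l)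
    (hρ' : ∀ t, ρ' t < l) (h : Killed l ρ) (h' : Killed l ρ') (hs : ∑ t, ρ t = ∑ t, ρ' t) :
    ρ = ρ' := by
  -- Any two such exponents are comparable entry by entry.
  have key : ∀ {σ τ : Fin n → ℕ}, (∀ t, σ t < l) → (∀ t, τ t < l) → Killed l σ → Killed l τ →
      (∃ i, σ i < τ i) → ∀ t, σ t ≤ τ t := by
    rintro σ τ hσ hτ kσ kτ ⟨i, hi⟩ t
    have h1 := hσ t
    have h2 := hτ i
    rcases lt_trichotomy t i with hti | rfl | hti
    · rcases kτ.eq_zero_or hl hτ hti with h | h <;> omega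
    · exact hi.le
    · rcases kσ.eq_zero_or hl hσ hti with h | h <;> omega
  by_cases hex : ∃ i, ρ i < ρ' i
  · exact funext fun t => (sum_eq_sum_iff_of_le fun t _ => key hρ hρ' h h' hex t).1 hs t (mem_univ t)
  · push Not at hex
    exact funext fun t => ((sum_eq_sum_iff_of_le fun t _ => hex t).1 hs.symm t (mem_univ t)).symm

lemma reflTransGen_lt_sum {n l : ℕ} {ρ ρ' : Fin n → ℕ} (hρ : ∀ t, ρ t < l)
    (h : Relation.ReflTransGen (Step l) ρ ρ') : (∀ t, ρ' t < l) ∧ ∑ t, ρ' t = ∑ t, ρ t := by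
  induction h with
  | refl => exact ⟨hρ, rfl⟩
  | tail _ h ih => exact ⟨h.lt ih.1, h.sum.trans ih.2⟩

lemma reflTransGen_symm {n l : ℕ} {ρ ρ' : Fin n → ℕ} (hρ : ∀ t, ρ t < l)
    (h : Relation.ReflTransGen (Step l) ρ ρ') : Relation.ReflTransGen (Step l) ρ' ρ := by
  induction h with
  | refl => exact .refl
  | tail h0 h ih => exact .head (h.symm (reflTransGen_lt_sum hρ h0).1) ih

/-- Any two restricted exponents of the same degree are joined by adjacent moves: both can be moved
to the one that is annihilated by all `e_i`. -/
lemma connected {n l : ℕ} (hl : 2 ≤ l) {ρ ρ' : Fin n → ℕ} (hρ : ∀ t, ρ t < l)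
    (hρ' : ∀ t, ρ' t < l) (hs : ∑ t, ρ t = ∑ t, ρ' t) :
    Relation.ReflTransGen (Step l) ρ ρ' := by
  obtain ⟨σ, h1, k1⟩ := exists_killed_of_lt ρ hρ
  obtain ⟨σ', h2, k2⟩ := exists_killed_of_lt ρ' hρ'
  have e1 := reflTransGen_lt_sum hρ h1
  have e2 := reflTransGen_lt_sum hρ' h2
  have : σ = σ' := k1.unique hl e1.1 e2.1 k2 (by rw [e1.2, e2.2, hs])
  subst this
  exact h1.trans (reflTransGen_symm hρ' h2)

/-- Induction along the moves that join two restricted exponents of the same degree. -/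
lemma connected_induction {n l : ℕ} (hl : 2 ≤ l) {P : (Fin n → ℕ) → Prop}
    (hP : ∀ ρ : Fin n → ℕ, (∀ t, ρ t < l) → ∀ a b, Adj a b → ρ a + 1 < l → ρ b ≠ 0 → P ρ →
      P (shift a b ρ))
    {ρ ρ' : Fin n → ℕ} (hρ : ∀ t, ρ t < l) (hρ' : ∀ t, ρ' t < l) (hs : ∑ t, ρ t = ∑ t, ρ' t)
    (h : P ρ) : P ρ' := by
  have := connected hl hρ hρ' hs
  clear hs hρ'
  induction this with
  | refl => exact h
  | tail h0 h1 ih =>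
    obtain ⟨a, b, hab, ha, hb, rfl⟩ := h1
    exact hP _ (reflTransGen_lt_sum hρ h0).1 a b hab ha hb ih

/-! ### The action on coefficients, and submodules spanned by monomials -/

lemma moveOp_apply_shift (q : kˣ) {n : ℕ} {a b : Fin n} (y : DivPow k n) {β : Fin n → ℕ}
    (hb : β b ≠ 0) : moveOp q a b y (shift a b β) = qInt q (β a + 1) * y β := by
  induction y using Finsupp.induction_linear with
  | zero => simp
  | add y z hy hz => rw [map_add, Finsupp.add_apply, hy, hz, Finsupp.add_apply, mul_add]
  | single γ c =>
    have h1 : (Finsupp.single γ c : DivPow k n) = c • mono k γ := by simp [mono]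
    rw [h1, map_smul]
    by_cases hγ : γ b = 0
    · have : γ ≠ β := by rintro rfl; exact hb hγ
      rw [moveOp_zero q hγ]
      simp [mono, this]
    · rw [moveOp_pos q hγ]
      by_cases h : γ = β
      · subst h
        simp [mono, mul_comm]
      · have h' : shift a b γ ≠ shift a b β := fun h0 => h (shift_injective hγ hb h0)
        simp [mono, h, h']

lemma exists_of_mem_support_moveOp {q : kˣ} (hq : 0 < qChar q) {n : ℕ} {a b : Fin n}
    {y : DivPow k n} {γ : Fin n → ℕ} (h : γ ∈ (moveOp q a b y).support) :
    ∃ β ∈ y.support, β b ≠ 0 ∧ ¬ qChar q ∣ β a + 1 ∧ γ = shift a b β := by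
  rw [Finsupp.mem_support_iff, moveOp, Finsupp.linearCombination_apply, Finsupp.sum,
    Finsupp.finsetSum_apply] at h
  obtain ⟨β, hβ, h1⟩ := exists_ne_zero_of_sum_ne_zero h
  refine ⟨β, hβ, ?_⟩
  by_cases hb : β b = 0
  · simp [hb] at h1
  · rw [if_neg hb, Finsupp.smul_apply, Finsupp.smul_apply, smul_eq_mul, smul_eq_mul] at h1
    refine ⟨hb, fun hd => ?_, ?_⟩
    · rw [(qInt_eq_zero_iff hq _).2 hd] at h1
      simp at h1
    · by_contra hne
      simp [mono, Ne.symm hne] at h1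

lemma shift_mem_support_moveOp {q : kˣ} (hq : 0 < qChar q) {n : ℕ} {a b : Fin n}
    {y : DivPow k n} {β : Fin n → ℕ} (hβ : β ∈ y.support) (hb : β b ≠ 0)
    (ha : ¬ qChar q ∣ β a + 1) : shift a b β ∈ (moveOp q a b y).support := by
  rw [Finsupp.mem_support_iff, moveOp_apply_shift q y hb]
  exact mul_ne_zero (fun h => ha ((qInt_eq_zero_iff hq _).1 h)) (Finsupp.mem_support_iff.1 hβ)

lemma diagOp_apply (q : kˣ) {n : ℕ} (a b : Fin n) (y : DivPow k n) (β : Fin n → ℕ) :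
    diagOp q a b y β = ((q ^ ((β a : ℤ) - (β b : ℤ)) : kˣ) : k) * y β := by
  induction y using Finsupp.induction_linear with
  | zero => simp
  | add y z hy hz => rw [map_add, Finsupp.add_apply, hy, hz, Finsupp.add_apply, mul_add]
  | single γ c =>
    have h1 : (Finsupp.single γ c : DivPow k n) = c • mono k γ := by simp [mono]
    rw [h1, map_smul, diagOp_mono]
    by_cases h : γ = β
    · subst h; simp [mono, mul_comm]
    · simp [mono, h]

lemma exists_gen_of_adj (q : kˣ) {n : ℕ} {a b : Fin n} (h : Adj a b) :
    ∃ g : Gen n, genOp q g = moveOp q a b := by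
  rcases h with h | h
  · exact ⟨.e ⟨a.val, by omega⟩, by simp [genOp, lo, hi, h]⟩
  · exact ⟨.f ⟨b.val, by omega⟩, by simp [genOp, lo, hi, h]⟩

lemma moveOp_mem {q : kˣ} {n : ℕ} (S : Submodule (SmallU q n) (DivPow k n)) {a b : Fin n}
    (h : Adj a b) {y : DivPow k n} (hy : y ∈ S) : moveOp q a b y ∈ S := by
  obtain ⟨g, hg⟩ := exists_gen_of_adj q h
  rw [← hg, ← genu_smul]
  exact S.smul_mem _ hy

/-- A set of exponents that is stable under the adjacent moves with non-zero coefficient, so that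
its monomials span a submodule. -/
def Stable (q : kˣ) {n : ℕ} (X : Set (Fin n → ℕ)) : Prop :=
  ∀ α ∈ X, ∀ a b : Fin n, Adj a b → α b ≠ 0 → ¬ qChar q ∣ α a + 1 → shift a b α ∈ X

/-- The submodule spanned by the monomials with exponents in a stable set. -/
def monoSub {q : kˣ} (hq : 0 < qChar q) {n : ℕ} {X : Set (Fin n → ℕ)} (hX : Stable q X) :
    Submodule (SmallU q n) (DivPow k n) :=
  { Finsupp.supported k k X with
    smul_mem' := by
      intro u y hy
      refine smul_mem_of_gen q (Finsupp.supported k k X) ?_ u y hy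
      intro g y hy
      have hmove : ∀ a b : Fin n, Adj a b → moveOp q a b y ∈ Finsupp.supported k k X := by
        intro a b hab γ hγ
        obtain ⟨β, hβ, hb, ha, rfl⟩ := exists_of_mem_support_moveOp hq hγ
        exact hX β (hy hβ) a b hab hb ha
      have hdiag : ∀ a b : Fin n, diagOp q a b y ∈ Finsupp.supported k k X := by
        intro a b γ hγ
        refine hy (Finsupp.mem_support_iff.2 fun h0 => Finsupp.mem_support_iff.1 hγ ?_)
        rw [diagOp_apply, h0, mul_zero]
      cases g with
      | e i => exact hmove _ _ (Or.inl rfl)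
      | f i => exact hmove _ _ (Or.inr rfl)
      | K i => exact hdiag _ _
      | Kinv i => exact hdiag _ _ }

section monoSub

variable {q : kˣ} {hq : 0 < qChar q} {n : ℕ} {X : Set (Fin n → ℕ)} {hX : Stable q X}

lemma mem_monoSub {y : DivPow k n} : y ∈ monoSub hq hX ↔ ∀ α ∈ y.support, α ∈ X := Iff.rfl

lemma monoSub_restrictScalars :
    (monoSub hq hX).restrictScalars k = Submodule.span k (mono k '' X) :=
  Finsupp.supported_eq_span_single k X

lemma mono_mem_monoSub {α : Fin n → ℕ} (h : α ∈ X) : mono k α ∈ monoSub hq hX := by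
  rw [mem_monoSub]
  intro β hβ
  have := Finsupp.support_single_subset hβ
  rw [mem_singleton] at this
  rwa [this]

lemma monoSub_le {S : Submodule (SmallU q n) (DivPow k n)} (h : ∀ α ∈ X, mono k α ∈ S) :
    monoSub hq hX ≤ S := by
  suffices (monoSub hq hX).restrictScalars k ≤ S.restrictScalars k from this
  rw [monoSub_restrictScalars, Submodule.span_le]
  rintro _ ⟨α, hα, rfl⟩
  exact h α hα

end monoSub

lemma mono_ne_zero {n : ℕ} (α : Fin n → ℕ) : mono k α ≠ 0 := by simp [mono]

lemma support_mono {n : ℕ} (α : Fin n → ℕ) : (mono k α).support = {α} :=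
  Finsupp.support_single _ (one_ne_zero)

lemma mem_homog {q : kˣ} {n m s : ℕ} {y : DivPow k n} :
    y ∈ homog q n m s ↔ ∀ α ∈ y.support, α ∈ index q n m s := by
  have : y ∈ homog q n m s ↔ y ∈ Submodule.span k (mono k '' index q n m s) := Iff.rfl
  rw [this]
  change y ∈ Submodule.span k ((fun α => Finsupp.single α 1) '' index q n m s) ↔ _
  rw [← Finsupp.supported_eq_span_single]
  rfl

lemma mono_mem_homog {q : kˣ} {n m s : ℕ} {α : Fin n → ℕ} (h : α ∈ index q n m s) :
    mono k α ∈ homog q n m s := by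
  rw [mem_homog, support_mono]
  simpa using h

lemma stable_index (q : kˣ) (n m s : ℕ) : Stable q (index q n m s) := by
  intro α hα a b hab hb ha
  refine ⟨by rw [sum_shift hab.ne α hb]; exact hα.1, fun t => ?_⟩
  have h1 := hα.2 t
  have h2 : α a + 1 ≠ m * qChar q := fun h => ha (h ▸ Dvd.intro_left m rfl)
  have h3 := hα.2 a
  simp only [shift]
  split_ifs <;> subst_vars <;> omega

lemma homog_eq_monoSub {q : kˣ} (hq : 0 < qChar q) (n m s : ℕ) :
    homog q n m s = monoSub hq (stable_index q n m s) :=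
  SetLike.ext fun _ => mem_homog

/-! ### Energy degrees -/

lemma div_shift {n l : ℕ} {a b : Fin n} (hab : a ≠ b) {α : Fin n → ℕ}
    (hb : α b ≠ 0) (ha : ¬ l ∣ α a + 1) (t : Fin n) :
    shift a b α t / l + (if t = b then if l ∣ α b then 1 else 0 else 0) = α t / l := by
  by_cases h1 : t = a
  · subst h1
    rw [shift_src hab, if_neg hab, add_zero, Nat.succ_div_of_not_dvd ha]
  · by_cases h2 : t = b
    · subst h2
      obtain ⟨d, hd⟩ := Nat.exists_eq_succ_of_ne_zero hb
      rw [shift_tgt hab, if_pos rfl, hd, Nat.succ_sub_one, Nat.succ_div]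
    · rw [shift_of_ne h1 h2, if_neg h2, add_zero]

lemma energy_shift {q : kˣ} {n : ℕ} {a b : Fin n} (hab : a ≠ b)
    {α : Fin n → ℕ} (hb : α b ≠ 0) (ha : ¬ qChar q ∣ α a + 1) :
    energy q (shift a b α) + (if qChar q ∣ α b then 1 else 0) = energy q α := by
  have h := sum_congr (rfl : (univ : Finset (Fin n)) = univ)
    fun t _ => div_shift hab hb ha t
  rw [sum_add_distrib, sum_ite_eq' univ b, if_pos (mem_univ b)] at h
  exact h

lemma energy_shift_le {q : kˣ} {n : ℕ} {a b : Fin n} (hab : a ≠ b)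
    {α : Fin n → ℕ} (hb : α b ≠ 0) (ha : ¬ qChar q ∣ α a + 1) :
    energy q (shift a b α) ≤ energy q α := by
  have := energy_shift hab hb ha
  omega

lemma energy_comb {q : kˣ} {n : ℕ} {κ ρ : Fin n → ℕ} (hρ : ∀ t, ρ t < qChar q) :
    energy q (comb (qChar q) κ ρ) = ∑ t, κ t :=
  sum_congr rfl fun t _ => comb_div hρ t

lemma energy_mul_add_sum_mod (q : kˣ) {n : ℕ} (α : Fin n → ℕ) :
    energy q α * qChar q + ∑ t, α t % qChar q = ∑ t, α t := by
  conv_rhs => rw [← comb_div_mod (qChar q) α, sum_comb]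
  rfl

lemma comb_mem_index {q : kˣ} {n m s : ℕ} {κ ρ : Fin n → ℕ} (hρ : ∀ t, ρ t < qChar q)
    (hκ : ∀ t, κ t < m) (hs : (∑ t, κ t) * qChar q + ∑ t, ρ t = s) :
    comb (qChar q) κ ρ ∈ index q n m s :=
  ⟨by rw [sum_comb, hs], fun t => comb_lt (hκ t) (hρ t)⟩

lemma div_lt_of_mem_index {q : kˣ} {n m s : ℕ} {α : Fin n → ℕ} (hα : α ∈ index q n m s)
    (t : Fin n) : α t / qChar q < m :=
  Nat.div_lt_of_lt_mul (by rw [mul_comm]; exact hα.2 t)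

lemma edeg_mono (q : kˣ) {n : ℕ} (α : Fin n → ℕ) : edeg q (mono k α) = energy q α := by
  rw [edeg, support_mono, sup_singleton]

lemma exists_energy_eq_edeg (q : kˣ) {n : ℕ} {y : DivPow k n} (hy : y ≠ 0) :
    ∃ α ∈ y.support, energy q α = edeg q y := by
  obtain ⟨α, h1, h2⟩ := exists_mem_eq_sup y.support (Finsupp.support_nonempty_iff.2 hy) (energy q)
  exact ⟨α, h1, h2.symm⟩

lemma index_nonempty {q : kˣ} {n m s : ℕ} (hm : 0 < m * qChar q)
    (hs : s ≤ n * (m * qChar q - 1)) : (index q n m s).Nonempty := by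
  obtain ⟨α, h1, h2⟩ := exists_sum_eq (fun _ : Fin n => m * qChar q - 1) s (by simpa using hs)
  exact ⟨α, h2, fun i => by have := h1 i; omega⟩

lemma minEnergy_le {q : kˣ} {n m s : ℕ} {α : Fin n → ℕ} (hα : α ∈ index q n m s) :
    minEnergy q n m s ≤ energy q α :=
  Nat.sInf_le ⟨mono k α, mono_mem_homog hα, mono_ne_zero α, edeg_mono q α⟩

lemma exists_energy_eq_minEnergy {q : kˣ} {n m s : ℕ} (h : (index q n m s).Nonempty) :
    ∃ α ∈ index q n m s, energy q α = minEnergy q n m s := by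
  obtain ⟨β, hβ⟩ := h
  obtain ⟨y, hy, hy0, he⟩ := Nat.sInf_mem (s := {e | ∃ y ∈ homog q n m s, y ≠ 0 ∧ edeg q y = e})
    ⟨_, mono k β, mono_mem_homog hβ, mono_ne_zero β, rfl⟩
  obtain ⟨α, h1, h2⟩ := exists_energy_eq_edeg q hy0
  exact ⟨α, mem_homog.1 hy α h1, h2.trans he⟩

lemma bddAbove_edeg (q : kˣ) (n m s : ℕ) :
    BddAbove {e | ∃ y ∈ homog q n m s, y ≠ 0 ∧ edeg q y = e} := by
  refine ⟨s, ?_⟩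
  rintro _ ⟨y, hy, -, rfl⟩
  refine Finset.sup_le fun α hα => ?_
  rw [← (mem_homog.1 hy α hα).1]
  exact sum_le_sum fun t _ => Nat.div_le_self _ _

lemma le_maxEnergy {q : kˣ} {n m s : ℕ} {α : Fin n → ℕ} (hα : α ∈ index q n m s) :
    energy q α ≤ maxEnergy q n m s :=
  le_csSup (bddAbove_edeg q n m s) ⟨mono k α, mono_mem_homog hα, mono_ne_zero α, edeg_mono q α⟩

lemma exists_energy_eq_maxEnergy {q : kˣ} {n m s : ℕ} (h : (index q n m s).Nonempty) :
    ∃ α ∈ index q n m s, energy q α = maxEnergy q n m s := by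
  obtain ⟨β, hβ⟩ := h
  obtain ⟨y, hy, hy0, he⟩ := Nat.sSup_mem (s := {e | ∃ y ∈ homog q n m s, y ≠ 0 ∧ edeg q y = e})
    ⟨_, mono k β, mono_mem_homog hβ, mono_ne_zero β, rfl⟩ (bddAbove_edeg q n m s)
  obtain ⟨α, h1, h2⟩ := exists_energy_eq_edeg q hy0
  exact ⟨α, mem_homog.1 hy α h1, h2.trans he⟩

lemma sum_mod_le {n l : ℕ} (hl : 0 < l) (α : Fin n → ℕ) : ∑ t, α t % l ≤ n * (l - 1) := by
  have := sum_le_card_nsmul univ (fun t => α t % l) (l - 1)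
    fun t _ => Nat.le_sub_one_of_lt (Nat.mod_lt _ hl)
  simpa using this

/-- If `β` has the same degree as `α` and smaller energy, then its remainders add up to at least `ℓ`
more than those of `α`. -/
lemma sum_mod_add_le {q : kˣ} {n : ℕ} {α β : Fin n → ℕ}
    (hs : ∑ t, β t = ∑ t, α t) (h : energy q β < energy q α) :
    ∑ t, α t % qChar q + qChar q ≤ ∑ t, β t % qChar q := by
  have h1 := energy_mul_add_sum_mod q α
  have h2 := energy_mul_add_sum_mod q β
  have h4 : (energy q β + 1) * qChar q ≤ energy q α * qChar q := Nat.mul_le_mul_right _ h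
  rw [add_mul, one_mul] at h4
  omega

/-- The exponents of minimal energy in `ℤ_+^n(s, 𝐦)`. -/
def bottom (q : kˣ) (n m s : ℕ) : Set (Fin n → ℕ) :=
  {α ∈ index q n m s | energy q α = minEnergy q n m s}

lemma stable_bottom (q : kˣ) (n m s : ℕ) : Stable q (bottom q n m s) := by
  intro α hα a b hab hb ha
  have h1 := stable_index q n m s α hα.1 a b hab hb ha
  exact ⟨h1, le_antisymm ((energy_shift_le hab.ne hb ha).trans_eq hα.2) (minEnergy_le h1)⟩

/-! ### Every non-zero submodule meets the span of the monomials of minimal energy -/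

/-- A non-zero submodule contains a vector all of whose monomials are annihilated by all `e_i`;
as the `e_i` are injective on the monomials they do not annihilate, these are the vectors
annihilated by all `e_i`. The monomials can be kept inside a given stable set. -/
lemma exists_killed {q : kˣ} (hq : 0 < qChar q) {n : ℕ}
    (S : Submodule (SmallU q n) (DivPow k n)) {X : Set (Fin n → ℕ)} (hX : Stable q X)
    (h : ∃ y ∈ S, y ≠ 0 ∧ ∀ α ∈ y.support, α ∈ X) :
    ∃ y ∈ S, y ≠ 0 ∧ (∀ α ∈ y.support, α ∈ X) ∧ ∀ α ∈ y.support, Killed (qChar q) α := by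
  obtain ⟨y, hy, hy0, hyX⟩ := h
  induction hp : y.support.sup pot using Nat.strong_induction_on generalizing y with
  | _ p ih =>
    by_cases hk : ∀ α ∈ y.support, Killed (qChar q) α
    · exact ⟨y, hy, hy0, hyX, hk⟩
    · simp only [Killed, not_forall, not_or] at hk
      obtain ⟨α, hα, a, b, hab, hb, ha⟩ := hk
      have hadj : Adj a b := Or.inl hab
      have h1 := shift_mem_support_moveOp hq hα hb ha
      refine ih _ ?_ (moveOp q a b y) (moveOp_mem S hadj hy)
        (Finsupp.support_nonempty_iff.1 ⟨_, h1⟩) ?_ rfl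
      · have hpos : 0 < p := by
          have h2 := pot_shift hab hb
          have h3 : pot α ≤ y.support.sup pot := Finset.le_sup hα
          omega
        rw [Finset.sup_lt_iff hpos]
        intro γ hγ
        obtain ⟨β, hβ, hb', -, rfl⟩ := exists_of_mem_support_moveOp hq hγ
        have h2 := pot_shift hab hb'
        have h3 : pot β ≤ y.support.sup pot := Finset.le_sup hβ
        omega
      · intro γ hγ
        obtain ⟨β, hβ, hb', ha', rfl⟩ := exists_of_mem_support_moveOp hq hγ
        exact hX β (hyX β hβ) a b hadj hb' ha'

lemma Killed.mod {n l : ℕ} {α : Fin n → ℕ} (h : Killed l α) :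
    Killed l fun t => α t % l := by
  intro a b hab
  refine (h a b hab).imp (fun h0 => by simp [h0]) fun h0 => ?_
  have : (α a % l + 1) % l = 0 := by
    rw [Nat.mod_add_mod]; exact Nat.mod_eq_zero_of_dvd h0
  exact Nat.dvd_of_mod_eq_zero this

lemma stable_energy_le (q : kˣ) (n e : ℕ) : Stable q {α : Fin n → ℕ | energy q α ≤ e} :=
  fun _ hα _ _ hab hb ha => (energy_shift_le hab.ne hb ha).trans hα

/-- Moving the remainders `ρ` of the top energy part of a vector to remainders `ρ'`. -/
lemma transport_top {q : kˣ} (hq : 2 ≤ qChar q) {n e : ℕ}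
    (S : Submodule (SmallU q n) (DivPow k n)) {κ ρ ρ' : Fin n → ℕ}
    (hρ : ∀ t, ρ t < qChar q) (hρ' : ∀ t, ρ' t < qChar q) (hs : ∑ t, ρ t = ∑ t, ρ' t)
    (h : ∃ y ∈ S, (∀ α ∈ y.support, energy q α ≤ e ∧
        (energy q α = e → ∀ t, α t % qChar q = ρ t)) ∧ comb (qChar q) κ ρ ∈ y.support) :
    ∃ y ∈ S, (∀ α ∈ y.support, energy q α ≤ e ∧
        (energy q α = e → ∀ t, α t % qChar q = ρ' t)) ∧ comb (qChar q) κ ρ' ∈ y.support := by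
  refine connected_induction hq (P := fun ρ => ∃ y ∈ S, (∀ α ∈ y.support, energy q α ≤ e ∧
        (energy q α = e → ∀ t, α t % qChar q = ρ t)) ∧ comb (qChar q) κ ρ ∈ y.support)
    ?_ hρ hρ' hs h
  rintro σ hσ a b hab ha hb ⟨y, hy, hy1, hy2⟩
  have hcb : comb (qChar q) κ σ b ≠ 0 := by simp [comb, hb]
  refine ⟨moveOp q a b y, moveOp_mem S hab hy, fun γ hγ => ?_, ?_⟩
  · obtain ⟨β, hβ, hb', ha', rfl⟩ := exists_of_mem_support_moveOp (by omega) hγ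
    have h1 := energy_shift_le hab.ne hb' ha'
    refine ⟨h1.trans (hy1 β hβ).1, fun he t => ?_⟩
    have h2 := (hy1 β hβ).2 (le_antisymm (hy1 β hβ).1 (he ▸ h1))
    have h3 : β = comb (qChar q) (fun t => β t / qChar q) σ := by
      conv_lhs => rw [← comb_div_mod (qChar q) β]
      rw [funext h2]
    rw [h3, shift_comb hb, comb_mod (shift_lt hσ ha)]
  · rw [← shift_comb hb]
    exact shift_mem_support_moveOp (by omega) hy2 hcb (not_dvd_comb_succ ha)

/-- The key fact: a non-zero submodule contains a non-zero combination of monomials of minimal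
energy. In a vector annihilated by all `e_i` the top energy monomials share their remainders; these
are moved to a position from which one further move lowers the energy. -/
lemma exists_mem_bottom {q : kˣ} (hq : 2 ≤ qChar q) {n m s : ℕ} (hn : 2 ≤ n)
    {S : Submodule (SmallU q n) (DivPow k n)} (hS : S ≤ homog q n m s) (h0 : S ≠ ⊥) :
    ∃ y ∈ S, y ≠ 0 ∧ y ∈ monoSub (by omega) (stable_bottom q n m s) := by
  classical
  obtain ⟨y₀, hy₀, hy₀0⟩ := S.ne_bot_iff.1 h0
  have hex : ∃ e, ∃ y ∈ S, y ≠ 0 ∧ ∀ α ∈ y.support, energy q α ≤ e :=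
    ⟨edeg q y₀, y₀, hy₀, hy₀0, fun α hα => Finset.le_sup hα⟩
  obtain ⟨y, hy, hy0, hye, hyk⟩ := exists_killed (by omega) S (stable_energy_le q n _)
    (Nat.find_spec hex)
  have hmin : ∀ e < Nat.find hex, ¬ ∃ y ∈ S, y ≠ 0 ∧ ∀ α ∈ y.support, energy q α ≤ e :=
    fun e he => Nat.find_min hex he
  generalize Nat.find hex = e at hye hmin
  have hidx : ∀ α ∈ y.support, α ∈ index q n m s := mem_homog.1 (hS hy)
  by_cases he : e ≤ minEnergy q n m s
  · exact ⟨y, hy, hy0, fun α hα => ⟨hidx α hα,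
      le_antisymm ((hye α hα).trans he) (minEnergy_le (hidx α hα))⟩⟩
  exfalso
  have hepos : 0 < e := by omega
  obtain ⟨α, hα, hαe⟩ : ∃ α ∈ y.support, energy q α = e := by
    by_contra hcon
    refine hmin (e - 1) (by omega) ⟨y, hy, hy0, fun α hα => ?_⟩
    have h1 : energy q α ≤ e := hye α hα
    have h2 : energy q α ≠ e := fun h => hcon ⟨α, hα, h⟩
    omega
  obtain ⟨β, hβ, hβe⟩ := exists_energy_eq_minEnergy ⟨α, hidx α hα⟩
  have hlt : ∀ (γ : Fin n → ℕ) (t : Fin n), γ t % qChar q < qChar q :=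
    fun γ t => Nat.mod_lt _ (by omega)
  have hroom := sum_mod_add_le (hβ.1.trans (hidx α hα).1.symm)
    (by rw [hβe, hαe]; omega : energy q β < energy q α)
  have hroom2 := sum_mod_le (by omega : 0 < qChar q) β
  -- A position with non-zero quotient.
  obtain ⟨j, hj⟩ : ∃ j, α j / qChar q ≠ 0 := by
    by_contra hcon
    push Not at hcon
    have : energy q α = 0 := sum_eq_zero fun t _ => hcon t
    omega
  obtain ⟨κ, hκ⟩ := exists_bump (κ := fun t => α t / qChar q) hj
  obtain ⟨i, ρ, ρ', hij, hρ, hρ', hsρ, hsρ', hρj, hρi, hshift⟩ :=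
    exists_descent hn hq (hroom.trans hroom2) j
  have htop : ∀ γ ∈ y.support, energy q γ ≤ e ∧
      (energy q γ = e → ∀ t, γ t % qChar q = α t % qChar q) := by
    intro γ hγ
    refine ⟨hye γ hγ, fun hγe => ?_⟩
    have h1 := energy_mul_add_sum_mod q α
    have h2 := energy_mul_add_sum_mod q γ
    rw [hαe] at h1
    rw [hγe] at h2
    rw [(hidx α hα).1] at h1
    rw [(hidx γ hγ).1] at h2
    exact congrFun (((hyk γ hγ).mod).unique hq (hlt γ) (hlt α) ((hyk α hα).mod) (by omega))
  have hmem : comb (qChar q) (fun t => α t / qChar q) (fun t => α t % qChar q) ∈ y.support := by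
    rw [comb_div_mod]; exact hα
  obtain ⟨z, hz, hz1, hz2⟩ := transport_top hq S (hlt α) hρ hsρ.symm ⟨y, hy, htop, hmem⟩
  rw [hκ] at hz2
  have hb : comb (qChar q) (bump j κ) ρ j ≠ 0 := by
    rw [comb, bump_same, add_mul, one_mul]; omega
  have h3 := shift_mem_support_moveOp (by omega) hz2 hb (not_dvd_comb_succ hρi)
  refine hmin (e - 1) (by omega) ⟨moveOp q i j z, moveOp_mem S hij hz,
    Finsupp.support_nonempty_iff.1 ⟨_, h3⟩, fun γ hγ => ?_⟩
  obtain ⟨δ, hδ, hδb, hδa, rfl⟩ := exists_of_mem_support_moveOp (by omega) hγ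
  have h4 := energy_shift hij.ne hδb hδa
  obtain ⟨h5, h6⟩ := hz1 δ hδ
  by_cases h7 : energy q δ = e
  · have : qChar q ∣ δ j := Nat.dvd_of_mod_eq_zero ((h6 h7 j).trans hρj)
    rw [if_pos this] at h4
    omega
  · omega

/-! ### Simple submodules and the socle -/

/-- Monomials of the same degree with the same quotients generate each other. -/
lemma mono_mem_of_div_eq {q : kˣ} (hq : 2 ≤ qChar q) {n : ℕ}
    (S : Submodule (SmallU q n) (DivPow k n)) {α β : Fin n → ℕ}
    (hs : ∑ t, α t = ∑ t, β t) (hd : ∀ t, α t / qChar q = β t / qChar q)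
    (h : mono k α ∈ S) : mono k β ∈ S := by
  have hlt : ∀ (γ : Fin n → ℕ) (t : Fin n), γ t % qChar q < qChar q :=
    fun γ t => Nat.mod_lt _ (by omega)
  have he : energy q α = energy q β := sum_congr rfl fun t _ => hd t
  have h1 := energy_mul_add_sum_mod q α
  have h2 := energy_mul_add_sum_mod q β
  rw [he] at h1
  rw [← comb_div_mod (qChar q) β, ← funext hd]
  refine connected_induction hq
    (P := fun ρ => mono k (comb (qChar q) (fun t => α t / qChar q) ρ) ∈ S) ?_ (hlt α) (hlt β)
    (by omega) (by rw [comb_div_mod]; exact h)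
  intro ρ hρ a b hab ha hb hm
  have h3 := moveOp_mem S hab hm
  rw [moveOp_pos q (by simp [comb, hb]), shift_comb hb] at h3
  have hc : qInt q (comb (qChar q) (fun t => α t / qChar q) ρ a + 1) ≠ 0 := fun h0 =>
    not_dvd_comb_succ ha ((qInt_eq_zero_iff (by omega) _).1 h0)
  have h4 := S.smul_of_tower_mem
    (qInt q (comb (qChar q) (fun t => α t / qChar q) ρ a + 1))⁻¹ h3
  rwa [smul_smul, inv_mul_cancel₀ hc, one_smul] at h4

/-- The exponents with the same degree and the same quotients as `α`. -/
def cell (q : kˣ) {n : ℕ} (α : Fin n → ℕ) : Set (Fin n → ℕ) :=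
  {β | ∑ t, β t = ∑ t, α t ∧ ∀ t, β t / qChar q = α t / qChar q}

lemma cell_subset_bottom {q : kˣ} {n m s : ℕ} {α : Fin n → ℕ} (hq : 0 < qChar q)
    (hα : α ∈ bottom q n m s) : cell q α ⊆ bottom q n m s := by
  intro β hβ
  refine ⟨⟨hβ.1.trans hα.1.1, fun t => ?_⟩, ?_⟩
  · have := div_lt_of_mem_index hα.1 t
    rw [← hβ.2 t, Nat.div_lt_iff_lt_mul hq] at this
    exact this
  · rw [← hα.2]; exact sum_congr rfl fun t _ => hβ.2 t

lemma stable_cell {q : kˣ} (hq : 0 < qChar q) {n m s : ℕ} {α : Fin n → ℕ}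
    (hα : α ∈ bottom q n m s) : Stable q (cell q α) := by
  intro β hβ a b hab hb ha
  have h1 := cell_subset_bottom hq hα hβ
  have h2 := stable_bottom q n m s β h1 a b hab hb ha
  have h3 := energy_shift hab.ne hb ha
  refine ⟨by rw [sum_shift hab.ne β hb]; exact hβ.1, fun t => ?_⟩
  have h4 := div_shift hab.ne hb ha t
  have h5 : ¬ qChar q ∣ β b := by
    intro h
    rw [if_pos h, h1.2, h2.2] at h3
    omega
  simp only [if_neg h5, ite_self, add_zero] at h4
  rw [h4, hβ.2 t]

lemma cyclic_le {q : kˣ} {n : ℕ} {S : Submodule (SmallU q n) (DivPow k n)} {y : DivPow k n} :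
    cyclic q y ≤ S ↔ y ∈ S := by
  rw [cyclic, Submodule.span_le, Set.singleton_subset_iff, SetLike.mem_coe]

lemma mem_cyclic (q : kˣ) {n : ℕ} (y : DivPow k n) : y ∈ cyclic q y :=
  Submodule.mem_span_singleton_self y

lemma cyclic_mono_eq {q : kˣ} (hq : 2 ≤ qChar q) {n m s : ℕ} {α : Fin n → ℕ}
    (hα : α ∈ bottom q n m s) :
    cyclic q (mono k α) = monoSub (by omega) (stable_cell (by omega) hα) := by
  refine le_antisymm (cyclic_le.2 (mono_mem_monoSub ⟨rfl, fun _ => rfl⟩)) (monoSub_le ?_)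
  exact fun β hβ => mono_mem_of_div_eq hq _ hβ.1.symm (fun t => (hβ.2 t).symm) (mem_cyclic q _)

lemma eq_of_killed_of_div_eq {l n : ℕ} (hl : 2 ≤ l) {α β : Fin n → ℕ} (hα : Killed l α)
    (hβ : Killed l β) (hs : ∑ t, α t = ∑ t, β t) (hd : ∀ t, α t / l = β t / l) : α = β := by
  have hlt : ∀ (γ : Fin n → ℕ) (t : Fin n), γ t % l < l := fun γ t => Nat.mod_lt _ (by omega)
  have h1 := sum_comb l (fun t => α t / l) (fun t => α t % l)
  have h2 := sum_comb l (fun t => β t / l) (fun t => β t % l)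
  rw [comb_div_mod] at h1 h2
  rw [funext hd] at h1
  rw [← comb_div_mod l α, ← comb_div_mod l β, funext hd,
    (hα.mod).unique hl (hlt α) (hlt β) (hβ.mod) (by omega)]

/-- A monomial of minimal energy generates a simple module: a submodule contains a vector
annihilated by all `e_i`, and there is only one monomial that can occur in it. -/
lemma isSimpleModule_cyclic_mono {q : kˣ} (hq : 2 ≤ qChar q) {n m s : ℕ} {α : Fin n → ℕ}
    (hα : α ∈ bottom q n m s) : IsSimpleModule (SmallU q n) (cyclic q (mono k α)) := by
  rw [isSimpleModule_iff_isAtom]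
  refine ⟨fun h => mono_ne_zero α ((Submodule.mem_bot (SmallU q n)).1 (h ▸ mem_cyclic q _)), ?_⟩
  intro S hS
  by_contra h0
  refine hS.not_ge (cyclic_le.2 ?_)
  obtain ⟨z, hz, hz0⟩ := S.ne_bot_iff.1 h0
  have hle : ∀ y ∈ S, y ∈ monoSub (by omega) (stable_cell (by omega) hα) := fun y hy =>
    cyclic_mono_eq hq hα ▸ hS.le hy
  obtain ⟨y, hy, hy0, hyX, hyk⟩ := exists_killed (by omega) S (stable_cell (by omega) hα)
    ⟨z, hz, hz0, hle z hz⟩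
  obtain ⟨β, hβ⟩ := Finsupp.support_nonempty_iff.2 hy0
  have hsupp : y.support ⊆ {β} := fun γ hγ => by
    have h1 := hyX γ hγ
    have h2 := hyX β hβ
    rw [mem_singleton]
    exact eq_of_killed_of_div_eq hq (hyk γ hγ) (hyk β hβ) (h1.1.trans h2.1.symm)
      fun t => (h1.2 t).trans (h2.2 t).symm
  have hyβ : y = y β • mono k β := by
    rw [mono, Finsupp.smul_single, smul_eq_mul, mul_one]
    exact Finsupp.support_subset_singleton.1 hsupp
  have hmem : mono k β ∈ S := by
    have h1 := S.smul_of_tower_mem (y β)⁻¹ hy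
    rw [hyβ, smul_smul] at h1
    simpa [mono, Finsupp.mem_support_iff.1 hβ] using h1
  exact mono_mem_of_div_eq hq S (hyX β hβ).1 (hyX β hβ).2 hmem

/-- A simple submodule lies in the span of the monomials of minimal energy. -/
lemma le_bottom_of_isSimpleModule {q : kˣ} (hq : 2 ≤ qChar q) {n m s : ℕ} (hn : 2 ≤ n)
    {S : Submodule (SmallU q n) (DivPow k n)} (hS : S ≤ homog q n m s)
    (h : IsSimpleModule (SmallU q n) S) : S ≤ monoSub (by omega) (stable_bottom q n m s) := by
  rw [isSimpleModule_iff_isAtom] at h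
  obtain ⟨y, hy, hy0, hyW⟩ := exists_mem_bottom hq hn hS h.1
  refine (h.le_iff.1 inf_le_left).resolve_left ?_ |>.ge.trans inf_le_right
  exact (Submodule.ne_bot_iff _).2 ⟨y, ⟨hy, hyW⟩, hy0⟩

lemma bottom_le_homog {q : kˣ} (hq : 0 < qChar q) (n m s : ℕ) :
    monoSub hq (stable_bottom q n m s) ≤ homog q n m s :=
  monoSub_le fun _ hα => mono_mem_homog hα.1

lemma isSimpleModule_map_subtype {R M : Type*} [Ring R] [AddCommGroup M] [Module R M]
    {N : Submodule R M} {S : Submodule R N} (h : IsSimpleModule R S) :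
    IsSimpleModule R (S.map N.subtype) :=
  IsSimpleModule.congr (Submodule.equivMapOfInjective _ (Submodule.subtype_injective _) S).symm

lemma isSimpleModule_comap_subtype {R M : Type*} [Ring R] [AddCommGroup M] [Module R M]
    {N S : Submodule R M} (hle : S ≤ N) (h : IsSimpleModule R S) :
    IsSimpleModule R (S.comap N.subtype) :=
  IsSimpleModule.congr (Submodule.comapSubtypeEquivOfLe hle)

lemma map_socle_le_iff {R M : Type*} [Ring R] [AddCommGroup M] [Module R M]
    {N W : Submodule R M} : (socle R N).map N.subtype ≤ W ↔
      ∀ S ≤ N, IsSimpleModule R S → S ≤ W := by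
  rw [Submodule.map_le_iff_le_comap, socle, sSup_le_iff]
  refine ⟨fun h S hS hsimple x hx => ?_, fun h S hS => ?_⟩
  · exact h _ (isSimpleModule_comap_subtype hS hsimple) (show (⟨x, hS hx⟩ : N) ∈ _ from hx)
  · rw [← Submodule.map_le_iff_le_comap]
    exact h _ (Submodule.map_subtype_le _ _) (isSimpleModule_map_subtype hS)

/-- The socle is spanned by the monomials of minimal energy. -/
lemma soc_eq {q : kˣ} (hq : 2 ≤ qChar q) {n : ℕ} (hn : 2 ≤ n) (m s : ℕ) :
    soc q n m s = monoSub (by omega) (stable_bottom q n m s) := by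
  apply le_antisymm
  · exact map_socle_le_iff.2 fun S hS h => le_bottom_of_isSimpleModule hq hn hS h
  · refine monoSub_le fun α hα => ?_
    exact map_socle_le_iff.1 le_rfl _ (cyclic_le.2 (mono_mem_homog hα.1))
      (isSimpleModule_cyclic_mono hq hα) (mem_cyclic q _)

lemma edeg_eq_minEnergy {q : kˣ} (hq : 0 < qChar q) {n m s : ℕ} {y : DivPow k n}
    (hy0 : y ≠ 0)
    (hy : y ∈ monoSub hq (stable_bottom q n m s)) : edeg q y = minEnergy q n m s := by
  obtain ⟨α, hα, he⟩ := exists_energy_eq_edeg q hy0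
  rw [← he]
  exact (mem_monoSub.1 hy α hα).2

/-! ### Generation by the monomials of maximal energy -/

lemma mono_mem_iSup_maxEnergy {q : kˣ} (hq : 2 ≤ qChar q) {n m s : ℕ} (hn : 2 ≤ n)
    {α : Fin n → ℕ} (hα : α ∈ index q n m s) :
    mono k α ∈ ⨆ β ∈ {β ∈ index q n m s | energy q β = maxEnergy q n m s},
      cyclic q (mono k β) := by
  induction hd : maxEnergy q n m s - energy q α generalizing α with
  | zero =>
    have hle := le_maxEnergy hα
    have hm : α ∈ {β ∈ index q n m s | energy q β = maxEnergy q n m s} := ⟨hα, by omega⟩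
    exact (le_iSup₂ (f := fun β _ => cyclic q (mono k β)) α hm) (mem_cyclic q _)
  | succ d ih =>
    obtain ⟨γ, hγ, hγe⟩ := exists_energy_eq_maxEnergy ⟨α, hα⟩
    have hlt : energy q α < energy q γ := by omega
    have hsum := hα.1.trans hγ.1.symm
    have hroom := sum_mod_add_le hsum hlt
    have hroom2 := sum_mod_le (by omega : 0 < qChar q) α
    -- A position whose quotient can be raised.
    obtain ⟨j, -, hj⟩ := exists_lt_of_sum_lt hlt
    have hjm := div_lt_of_mem_index hγ j
    obtain ⟨i, ρ, ρ', hij, hρ, hρ', hsρ, hsρ', hρj, hρi, hshift⟩ :=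
      exists_descent (t := ∑ t, α t % qChar q - qChar q) hn hq (by omega) j
    set κ : Fin n → ℕ := fun t => α t / qChar q with hκ
    have hκm : ∀ t, bump j κ t < m := by
      intro t
      have := div_lt_of_mem_index hα t
      simp only [bump, hκ]
      split_ifs with h
      · subst h; omega
      · omega
    have hE := energy_mul_add_sum_mod q α
    have hβ : comb (qChar q) (bump j κ) ρ ∈ index q n m s := by
      refine comb_mem_index hρ hκm ?_
      rw [sum_bump, add_mul, one_mul, ← hα.1]
      have : (∑ t, κ t) = energy q α := rfl
      rw [this]
      omega
    have hβe : energy q (comb (qChar q) (bump j κ) ρ) = energy q α + 1 := by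
      rw [energy_comb hρ, sum_bump]; rfl
    have h1 := moveOp_mem _ hij (ih hβ (by omega))
    have hb : comb (qChar q) (bump j κ) ρ j ≠ 0 := by
      rw [comb, bump_same, add_mul, one_mul]; omega
    rw [moveOp_pos q hb, hshift] at h1
    have hc : qInt q (comb (qChar q) (bump j κ) ρ i + 1) ≠ 0 := fun h0 =>
      not_dvd_comb_succ hρi ((qInt_eq_zero_iff (by omega) _).1 h0)
    have h2 := Submodule.smul_of_tower_mem _
      (qInt q (comb (qChar q) (bump j κ) ρ i + 1))⁻¹ h1
    rw [smul_smul, inv_mul_cancel₀ hc, one_smul] at h2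
    refine mono_mem_of_div_eq hq _ ?_ (fun t => comb_div hρ' t) h2
    rw [sum_comb, hsρ', ← hE]
    have : (∑ t, κ t) = energy q α := rfl
    rw [this]
    omega

lemma homog_eq_iSup_maxEnergy {q : kˣ} (hq : 2 ≤ qChar q) {n m s : ℕ} (hn : 2 ≤ n) :
    homog q n m s = ⨆ β ∈ {β ∈ index q n m s | energy q β = maxEnergy q n m s},
      cyclic q (mono k β) := by
  apply le_antisymm
  · rw [homog_eq_monoSub (by omega : 0 < qChar q)]
    exact monoSub_le fun α hα => mono_mem_iSup_maxEnergy hq hn hα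
  · exact iSup₂_le fun β hβ => cyclic_le.2 (mono_mem_homog hβ.1)

/-! ### Endomorphisms act on the socle by scalars -/

/-- A linear map of `A_q(n)` that restricts to a `u_q(sl_n)`-endomorphism of the component
`A_q^{(s)}(n, 𝐦)`; only the compatibility with the `e_i` and `f_i` is recorded. -/
structure IsIntertwiner (q : kˣ) (n m s : ℕ) (T : Module.End k (DivPow k n)) : Prop where
  mem : ∀ y ∈ homog q n m s, T y ∈ homog q n m s
  comm : ∀ a b : Fin n, Adj a b → ∀ y ∈ homog q n m s, T (moveOp q a b y) = moveOp q a b (T y)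

/-- The coefficient of `x^(β)` in `T x^(α)` is what it is for the scalar `z`. -/
def ScalarAt {n : ℕ} (T : Module.End k (DivPow k n)) (z : k) (α β : Fin n → ℕ) : Prop :=
  T (mono k α) β = if α = β then z else 0

/-- `ScalarAt` for all pairs of exponents of degree `s` with quotients `κ`, `μ` and equal
remainders. -/
def ScalarOn (q : kˣ) {n : ℕ} (s : ℕ) (T : Module.End k (DivPow k n)) (z : k)
    (κ μ : Fin n → ℕ) : Prop :=
  ∀ ρ : Fin n → ℕ, (∀ t, ρ t < qChar q) → (∑ t, κ t) * qChar q + ∑ t, ρ t = s →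
    ScalarAt T z (comb (qChar q) κ ρ) (comb (qChar q) μ ρ)

section ScalarAt

variable {q : kˣ} {n m s : ℕ} {T : Module.End k (DivPow k n)} {z : k}

lemma IsIntertwiner.coeff_shift (hT : IsIntertwiner q n m s T) {a b : Fin n} (hab : Adj a b)
    {α β : Fin n → ℕ} (hα : α ∈ index q n m s) (hαb : α b ≠ 0) (hβb : β b ≠ 0) :
    qInt q (α a + 1) * T (mono k (shift a b α)) (shift a b β)
      = qInt q (β a + 1) * T (mono k α) β := by
  have h := hT.comm a b hab _ (mono_mem_homog hα)
  rw [moveOp_pos q hαb, map_smul] at h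
  rw [← moveOp_apply_shift q _ hβb, ← h, Finsupp.smul_apply, smul_eq_mul]

/-- A move with non-zero coefficients on both sides carries `ScalarAt` along. -/
lemma IsIntertwiner.scalarAt_shift (hT : IsIntertwiner q n m s T) (hq : 0 < qChar q)
    {a b : Fin n} (hab : Adj a b) {α β : Fin n → ℕ} (hα : α ∈ index q n m s) (hαb : α b ≠ 0)
    (hβb : β b ≠ 0) (hαa : ¬ qChar q ∣ α a + 1) (hβa : ¬ qChar q ∣ β a + 1) :
    ScalarAt T z (shift a b α) (shift a b β) ↔ ScalarAt T z α β := by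
  have h := hT.coeff_shift hab hα hαb hβb
  have h1 : qInt q (α a + 1) ≠ 0 := fun h0 => hαa ((qInt_eq_zero_iff hq _).1 h0)
  have h2 : qInt q (β a + 1) ≠ 0 := fun h0 => hβa ((qInt_eq_zero_iff hq _).1 h0)
  by_cases hne : α = β
  · subst hne
    rw [ScalarAt, ScalarAt, mul_left_cancel₀ h1 h, if_pos rfl, if_pos rfl]
  · have hne' : shift a b α ≠ shift a b β := fun h0 => hne (shift_injective hαb hβb h0)
    rw [ScalarAt, ScalarAt, if_neg hne, if_neg hne']
    constructor
    · intro h0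
      rw [h0, mul_zero] at h
      exact (mul_eq_zero.1 h.symm).resolve_left h2
    · intro h0
      rw [h0, mul_zero] at h
      exact (mul_eq_zero.1 h).resolve_left h1

lemma IsIntertwiner.scalarAt_of_eq_zero (hT : IsIntertwiner q n m s T) (hq : 0 < qChar q)
    {a b : Fin n} (hab : Adj a b) {α β : Fin n → ℕ} (hα : α ∈ index q n m s) (hαb : α b = 0)
    (hβb : β b ≠ 0) (hβa : ¬ qChar q ∣ β a + 1) : ScalarAt T z α β := by
  have h := hT.comm a b hab _ (mono_mem_homog hα)
  rw [moveOp_zero q hαb, map_zero] at h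
  have h3 := moveOp_apply_shift q (a := a) (T (mono k α)) hβb
  rw [← h, Finsupp.zero_apply, zero_eq_mul] at h3
  have hne : α ≠ β := by rintro rfl; exact hβb hαb
  rw [ScalarAt, if_neg hne]
  exact h3.resolve_left fun h0 => hβa ((qInt_eq_zero_iff hq _).1 h0)

lemma IsIntertwiner.scalarAt_of_notMem (hT : IsIntertwiner q n m s T) {α β : Fin n → ℕ}
    (hα : α ∈ index q n m s) (hβ : β ∉ index q n m s) : ScalarAt T z α β := by
  have hne : α ≠ β := by rintro rfl; exact hβ hα
  rw [ScalarAt, if_neg hne]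
  by_contra h
  exact hβ (mem_homog.1 (hT.mem _ (mono_mem_homog hα)) β (Finsupp.mem_support_iff.2 h))

/-- It suffices to check `ScalarOn` for one choice of the remainders. -/
lemma IsIntertwiner.scalarOn_of (hT : IsIntertwiner q n m s T) (hq : 2 ≤ qChar q)
    {κ μ ρ : Fin n → ℕ} (hκ : ∀ t, κ t < m) (hρ : ∀ t, ρ t < qChar q)
    (hs : (∑ t, κ t) * qChar q + ∑ t, ρ t = s)
    (h : ScalarAt T z (comb (qChar q) κ ρ) (comb (qChar q) μ ρ)) : ScalarOn q s T z κ μ := by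
  intro ρ' hρ' hs'
  refine (connected_induction hq (P := fun ρ => (∑ t, κ t) * qChar q + ∑ t, ρ t = s ∧
    ScalarAt T z (comb (qChar q) κ ρ) (comb (qChar q) μ ρ)) ?_ hρ hρ' (by omega) ⟨hs, h⟩).2
  rintro σ hσ a b hab ha hb ⟨h1, h2⟩
  refine ⟨by rw [sum_shift hab.ne σ hb, h1], ?_⟩
  rw [← shift_comb hb, ← shift_comb hb]
  exact (hT.scalarAt_shift (by omega) hab (comb_mem_index hσ hκ h1) (by simp [comb, hb])
    (by simp [comb, hb]) (not_dvd_comb_succ ha) (not_dvd_comb_succ ha)).2 h2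

/-- Comparison of neighbouring energies: lowering the `j`-th quotient intertwines. -/
lemma IsIntertwiner.scalarOn_bump (hT : IsIntertwiner q n m s T) (hq : 2 ≤ qChar q) (hn : 2 ≤ n)
    {κ μ : Fin n → ℕ} (hκ : ∀ t, κ t < m) {j : Fin n} (hj : κ j + 1 < m)
    (h1 : (∑ t, κ t + 1) * qChar q ≤ s) (h2 : s ≤ (∑ t, κ t) * qChar q + n * (qChar q - 1)) :
    ScalarOn q s T z κ μ ↔ ScalarOn q s T z (bump j κ) (bump j μ) := by
  obtain ⟨i, ρ, ρ', hij, hρ, hρ', hsρ, hsρ', hρj, hρi, hshift⟩ :=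
    exists_descent (t := s - (∑ t, κ t + 1) * qChar q) hn hq
      (by rw [add_mul] at h1 ⊢; omega) j
  have hκ' : ∀ t, bump j κ t < m := fun t => by
    have := hκ t
    simp only [bump]
    split_ifs with h
    · subst h; omega
    · omega
  have hs : (∑ t, bump j κ t) * qChar q + ∑ t, ρ t = s := by rw [sum_bump]; omega
  have hs' : (∑ t, κ t) * qChar q + ∑ t, ρ' t = s := by rw [add_mul] at h1 hsρ'; omega
  have hpos : ∀ ν : Fin n → ℕ, comb (qChar q) (bump j ν) ρ j ≠ 0 := fun ν => by
    rw [comb, bump_same, add_mul, one_mul]; omega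
  have key := hT.scalarAt_shift (z := z) (by omega) hij (comb_mem_index hρ hκ' hs) (hpos κ)
    (hpos μ) (not_dvd_comb_succ hρi) (not_dvd_comb_succ hρi)
  rw [hshift, hshift] at key
  exact ⟨fun h => hT.scalarOn_of hq hκ' hρ hs (key.1 (h ρ' hρ' hs')),
    fun h => hT.scalarOn_of hq hκ hρ' hs' (key.2 (h ρ hρ hs))⟩

lemma IsIntertwiner.scalarOn_of_eq_zero (hT : IsIntertwiner q n m s T) (hq : 2 ≤ qChar q)
    (hn : 2 ≤ n) {κ μ : Fin n → ℕ} (hκ : ∀ t, κ t < m) {j : Fin n} (hκj : κ j = 0)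
    (hμj : μ j ≠ 0) (h1 : (∑ t, κ t) * qChar q ≤ s)
    (h2 : s + qChar q ≤ (∑ t, κ t) * qChar q + n * (qChar q - 1)) : ScalarOn q s T z κ μ := by
  obtain ⟨i, ρ, ρ', hij, hρ, hρ', hsρ, hsρ', hρj, hρi, hshift⟩ :=
    exists_descent (t := s - (∑ t, κ t) * qChar q) hn hq (by omega) j
  have hs : (∑ t, κ t) * qChar q + ∑ t, ρ t = s := by omega
  refine hT.scalarOn_of hq hκ hρ hs (hT.scalarAt_of_eq_zero (by omega) hij
    (comb_mem_index hρ hκ hs) (by simp [comb, hκj, hρj]) ?_ (not_dvd_comb_succ hρi))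
  have : qChar q ≠ 0 := by omega
  simp [comb, hμj, this]

lemma IsIntertwiner.scalarOn_of_le (hT : IsIntertwiner q n m s T)
    {κ μ : Fin n → ℕ} (hκ : ∀ t, κ t < m) {j : Fin n} (hμj : m ≤ μ j) : ScalarOn q s T z κ μ := by
  intro ρ hρ hs
  refine hT.scalarAt_of_notMem (comb_mem_index hρ hκ hs) fun h => ?_
  have h1 := h.2 j
  have h2 : m * qChar q ≤ μ j * qChar q := Nat.mul_le_mul_right _ hμj
  simp only [comb] at h1
  omega

end ScalarAt

/-- The off-diagonal entries vanish. Let `κ_i < μ_i`. The pair `(κ, μ)` can be translated by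
`ε_i - ε_j` until `μ_i` exceeds the bound `m - 1` or `κ_j` becomes zero before `μ_j`; this is blocked
only if `μ = r ε_i` with `r < m - 1`. If `r < m - 1`, one translates by `ε_j - ε_i` instead, which
never exceeds the bound, until `κ_i` is zero. -/
lemma IsIntertwiner.scalarOn_of_ne {q : kˣ} {n m s : ℕ} {T : Module.End k (DivPow k n)} {z : k}
    (hT : IsIntertwiner q n m s T) (hq : 2 ≤ qChar q) (hn : 2 ≤ n) {r : ℕ}
    (h1 : (r + 1) * qChar q ≤ s) (h2 : s ≤ r * qChar q + n * (qChar q - 1))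
    {κ μ : Fin n → ℕ} (hκ : ∀ t, κ t < m) (hμ : ∀ t, μ t < m) (hκr : ∑ t, κ t = r)
    (hμr : ∑ t, μ t = r) {i : Fin n} (hi : κ i < μ i) : ScalarOn q s T z κ μ := by
  have hbump : ∀ ν : Fin n → ℕ, (∀ t, ν t < m) → ∀ j, ν j + 1 < m → ∀ t, bump j ν t < m := by
    intro ν hν j hj t
    have := hν t
    simp only [bump]
    split_ifs with h
    · subst h; omega
    · omega
  have hshift : ∀ ν : Fin n → ℕ, (∀ t, ν t < m) → ∀ a b, ν a + 1 < m → ∀ t, shift a b ν t < m := by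
    intro ν hν a b ha t
    have := hν t
    simp only [shift]
    split_ifs <;> subst_vars <;> omega
  have h3 : s + qChar q ≤ (r + 1) * qChar q + n * (qChar q - 1) := by rw [add_mul]; omega
  by_cases hrm : m ≤ r + 1
  · induction hd : m - μ i using Nat.strong_induction_on generalizing κ μ with
    | _ d ih =>
      have hκi : κ i + 1 < m := by have := hμ i; omega
      have hκ' := hbump κ hκ i hκi
      have hκr' : ∑ t, bump i κ t = r + 1 := by rw [sum_bump, hκr]
      rw [hT.scalarOn_bump hq hn hκ hκi (by rwa [hκr]) (by rwa [hκr])]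
      by_cases hμi : μ i + 1 < m
      · obtain ⟨j, hji, hj⟩ : ∃ j, j ≠ i ∧ μ j ≠ 0 := by
          by_contra hcon
          push Not at hcon
          rw [Fintype.sum_eq_single i hcon] at hμr
          omega
        by_cases hκj : κ j = 0
        · exact hT.scalarOn_of_eq_zero hq hn hκ' (j := j) (by rwa [bump_of_ne hji])
            (by rwa [bump_of_ne hji]) (by rwa [hκr']) (by rwa [hκr'])
        · have e1 : ∑ t, shift i j κ t = r := by rw [sum_shift hji.symm κ hκj, hκr]
          have e2 : ∑ t, shift i j μ t = r := by rw [sum_shift hji.symm μ hj, hμr]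
          rw [← bump_shift hji.symm hκj, ← bump_shift hji.symm hj,
            ← hT.scalarOn_bump hq hn (hshift κ hκ i j hκi)
              (by rw [shift_tgt hji.symm]; have := hκ j; omega) (by rwa [e1]) (by rwa [e1])]
          refine ih (m - shift i j μ i) ?_ (hshift κ hκ i j hκi) (hshift μ hμ i j hμi) e1 e2
            ?_ rfl
          · rw [shift_src hji.symm]; omega
          · rw [shift_src hji.symm, shift_src hji.symm]; omega
      · exact hT.scalarOn_of_le hκ' (j := i) (by rw [bump_same]; omega)
  · have hle : ∀ (ν : Fin n → ℕ) (t : Fin n), ∑ x, ν x = r → ν t ≤ r := fun ν t h =>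
      h ▸ single_le_sum (f := ν) (fun _ _ => Nat.zero_le _) (mem_univ t)
    obtain ⟨j, hj⟩ := exists_adj hn i
    have hji := hj.ne
    induction hd : κ i using Nat.strong_induction_on generalizing κ μ with
    | _ d ih =>
      have hκj : κ j + 1 < m := by have := hle κ j hκr; omega
      have hμj : μ j + 1 < m := by have := hle μ j hμr; omega
      have hκ' := hbump κ hκ j hκj
      have hκr' : ∑ t, bump j κ t = r + 1 := by rw [sum_bump, hκr]
      rw [hT.scalarOn_bump hq hn hκ hκj (by rwa [hκr]) (by rwa [hκr])]
      have hμi : μ i ≠ 0 := by omega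
      by_cases hκi : κ i = 0
      · exact hT.scalarOn_of_eq_zero hq hn hκ' (j := i) (by rwa [bump_of_ne hji.symm])
          (by rwa [bump_of_ne hji.symm]) (by rwa [hκr']) (by rwa [hκr'])
      · have e1 : ∑ t, shift j i κ t = r := by rw [sum_shift hji κ hκi, hκr]
        have e2 : ∑ t, shift j i μ t = r := by rw [sum_shift hji μ hμi, hμr]
        rw [← bump_shift hji hκi, ← bump_shift hji hμi,
          ← hT.scalarOn_bump hq hn (hshift κ hκ j i hκj)
            (by rw [shift_tgt hji]; have := hκ i; omega) (by rwa [e1]) (by rwa [e1])]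
        refine ih (shift j i κ i) ?_ (hshift κ hκ j i hκj) (hshift μ hμ j i hμj) e1 e2 ?_ rfl
        · rw [shift_tgt hji]; omega
        · rw [shift_tgt hji, shift_tgt hji]; omega

/-- The diagonal entries agree: translate `κ` towards `κ'`. -/
lemma IsIntertwiner.scalarOn_diag {q : kˣ} {n m s : ℕ} {T : Module.End k (DivPow k n)} {z : k}
    (hT : IsIntertwiner q n m s T) (hq : 2 ≤ qChar q) (hn : 2 ≤ n) {r : ℕ}
    (h1 : (r + 1) * qChar q ≤ s) (h2 : s ≤ r * qChar q + n * (qChar q - 1))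
    {κ κ' : Fin n → ℕ} (hκ : ∀ t, κ t < m) (hκ' : ∀ t, κ' t < m) (hκr : ∑ t, κ t = r)
    (hκr' : ∑ t, κ' t = r) (h : ScalarOn q s T z κ κ) : ScalarOn q s T z κ' κ' := by
  induction hd : ∑ t, (κ t - κ' t) using Nat.strong_induction_on generalizing κ with
  | _ d ih =>
    by_cases hle : ∀ t, κ t ≤ κ' t
    · have : κ = κ' := funext fun t =>
        (sum_eq_sum_iff_of_le fun t _ => hle t).1 (hκr.trans hκr'.symm) t (mem_univ t)
      rwa [← this]
    · push Not at hle
      obtain ⟨i, hi⟩ := hle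
      obtain ⟨j, -, hj⟩ : ∃ j ∈ univ, κ j < κ' j := by
        by_contra hcon
        push Not at hcon
        exact absurd (hκr.trans hκr'.symm) (sum_lt_sum hcon ⟨i, mem_univ i, hi⟩).ne'
      have hji : j ≠ i := by rintro rfl; omega
      have hκj : κ j + 1 < m := by have := hκ' j; omega
      have hκi : κ i ≠ 0 := by omega
      have hs : ∀ t, shift j i κ t < m := fun t => by
        have := hκ t
        simp only [shift]
        split_ifs <;> subst_vars <;> omega
      have e1 : ∑ t, shift j i κ t = r := by rw [sum_shift hji κ hκi, hκr]
      refine ih (∑ t, (shift j i κ t - κ' t)) ?_ hs e1 ?_ rfl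
      · rw [← hd]
        refine sum_lt_sum (fun t _ => ?_) ⟨i, mem_univ i, by rw [shift_tgt hji]; omega⟩
        simp only [shift]
        split_ifs <;> subst_vars <;> omega
      · rw [hT.scalarOn_bump hq hn hs (j := i) (by rw [shift_tgt hji]; have := hκ i; omega)
          (by rwa [e1]) (by rwa [e1]), bump_shift hji hκi,
          ← hT.scalarOn_bump hq hn hκ hκj (by rwa [hκr]) (by rwa [hκr])]
        exact h

/-- If the degree is at least `ℓ`, there is room for one more unit of energy above the minimal
energy `r`. -/
lemma minEnergy_room {q : kˣ} (hq : 2 ≤ qChar q) {n m s : ℕ} (hn : 3 ≤ n) (hs : qChar q ≤ s)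
    {α : Fin n → ℕ} (hα : α ∈ bottom q n m s) :
    (energy q α + 1) * qChar q ≤ s ∧ s ≤ energy q α * qChar q + n * (qChar q - 1) := by
  have hE := energy_mul_add_sum_mod q α
  have hle := sum_mod_le (by omega : 0 < qChar q) α
  rw [hα.1.1] at hE
  refine ⟨?_, by omega⟩
  by_cases h0 : energy q α = 0
  · rw [h0]; omega
  -- Otherwise the remainders leave no room for lowering the energy.
  have hnr : n * (qChar q - 1) < ∑ t, α t % qChar q + qChar q := by
    by_contra hcon
    obtain ⟨j, hj⟩ : ∃ j, α j / qChar q ≠ 0 := by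
      by_contra hcon
      push Not at hcon
      exact h0 (sum_eq_zero fun t _ => hcon t)
    obtain ⟨κ, hκ⟩ := exists_bump (κ := fun t => α t / qChar q) hj
    obtain ⟨-, -, ρ', -, -, hρ', -, hsρ', -⟩ :=
      exists_descent (l := qChar q) (by omega : 2 ≤ n) hq (not_lt.1 hcon) j
    have hsum : energy q α = ∑ t, κ t + 1 := by rw [← sum_bump j κ, ← hκ]; rfl
    have hmem : comb (qChar q) κ ρ' ∈ index q n m s := by
      refine comb_mem_index hρ' (fun t => ?_) ?_
      · have h3 := div_lt_of_mem_index hα.1 t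
        have h4 := congrFun hκ t
        simp only [bump] at h4
        omega
      · rw [hsum, add_mul] at hE
        omega
    have h5 := minEnergy_le hmem
    rw [energy_comb hρ', ← hα.2] at h5
    omega
  have h6 : 3 * (qChar q - 1) ≤ n * (qChar q - 1) := Nat.mul_le_mul_right _ hn
  rw [add_mul]
  omega

lemma killed_of_killed_mod {q : kˣ} {n m s : ℕ} {α : Fin n → ℕ} (hα : α ∈ bottom q n m s)
    (h : Killed (qChar q) fun t => α t % qChar q) : Killed (qChar q) α := by
  intro a b hab
  by_contra hcon
  push Not at hcon
  have hadj : Adj a b := Or.inl hab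
  have h1 := stable_bottom q n m s α hα a b hadj hcon.1 hcon.2
  have h2 := energy_shift hadj.ne hcon.1 hcon.2
  rw [h1.2, hα.2] at h2
  rcases h a b hab with h0 | h0
  · rw [if_pos (Nat.dvd_of_mod_eq_zero h0)] at h2
    omega
  · refine hcon.2 (Nat.dvd_of_mod_eq_zero ?_)
    rw [← Nat.mod_add_mod]
    exact Nat.mod_eq_zero_of_dvd h0

/-- An intertwiner that preserves the span of the monomials of minimal energy acts on it by a
scalar. -/
lemma IsIntertwiner.exists_scalar {q : kˣ} {n m s : ℕ} {T : Module.End k (DivPow k n)}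
    (hT : IsIntertwiner q n m s T) (hq : 2 ≤ qChar q) (hn : 3 ≤ n) (hs : qChar q ≤ s)
    (hne : (index q n m s).Nonempty)
    (hW : ∀ y ∈ monoSub (by omega) (stable_bottom q n m s),
      T y ∈ monoSub (by omega) (stable_bottom q n m s)) :
    ∃ z : k, ∀ y ∈ monoSub (by omega) (stable_bottom q n m s), T y = z • y := by
  have hlt : ∀ (γ : Fin n → ℕ) (t : Fin n), γ t % qChar q < qChar q :=
    fun γ t => Nat.mod_lt _ (by omega)
  have hn2 : 2 ≤ n := by omega
  obtain ⟨α₀, hα₀⟩ := exists_energy_eq_minEnergy hne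
  obtain ⟨h1, h2⟩ := minEnergy_room hq hn hs hα₀
  set κ₀ : Fin n → ℕ := fun t => α₀ t / qChar q with hκ₀
  have hκ₀m : ∀ t, κ₀ t < m := div_lt_of_mem_index hα₀.1
  set z := T (mono k α₀) α₀ with hz
  have hz0 : ScalarOn q s T z κ₀ κ₀ := by
    refine hT.scalarOn_of hq (ρ := fun t => α₀ t % qChar q) hκ₀m (hlt α₀) ?_ ?_
    · have := energy_mul_add_sum_mod q α₀
      rw [hα₀.1.1] at this
      exact this
    · rw [hκ₀, comb_div_mod, ScalarAt, if_pos rfl]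
  have hall : ∀ κ μ : Fin n → ℕ, (∀ t, κ t < m) → (∀ t, μ t < m) → ∑ t, κ t = energy q α₀ →
      ∑ t, μ t = energy q α₀ → ScalarOn q s T z κ μ := by
    intro κ μ hκ hμ hκr hμr
    by_cases hle : ∀ t, μ t ≤ κ t
    · have : μ = κ := funext fun t =>
        (sum_eq_sum_iff_of_le fun t _ => hle t).1 (hμr.trans hκr.symm) t (mem_univ t)
      rw [this]
      exact hT.scalarOn_diag hq hn2 h1 h2 hκ₀m hκ rfl hκr hz0
    · push Not at hle
      obtain ⟨i, hi⟩ := hle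
      exact hT.scalarOn_of_ne hq hn2 h1 h2 hκ hμ hκr hμr hi
  -- On a monomial annihilated by all `e_i` the remainders are preserved.
  have hkilled : ∀ α ∈ bottom q n m s, Killed (qChar q) α → T (mono k α) = z • mono k α := by
    intro α hα hk
    have hαE := energy_mul_add_sum_mod q α
    have hsup : ∀ β ∈ (T (mono k α)).support,
        β ∈ bottom q n m s ∧ ∀ t, β t % qChar q = α t % qChar q := by
      intro β hβ
      have hβW := mem_monoSub.1 (hW _ (mono_mem_monoSub hα)) β hβ
      have hβk : Killed (qChar q) β := by
        intro a b hab
        by_contra hcon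
        push Not at hcon
        have h5 := shift_mem_support_moveOp (by omega) hβ hcon.1 hcon.2
        rw [← hT.comm a b (Or.inl hab) _ (mono_mem_homog hα.1)] at h5
        have h6 : moveOp q a b (mono k α) = 0 := by
          rcases hk a b hab with h0 | h0
          · exact moveOp_zero q h0
          · by_cases hb : α b = 0
            · exact moveOp_zero q hb
            · rw [moveOp_pos q hb, (qInt_eq_zero_iff (by omega) _).2 h0, zero_smul]
        rw [h6, map_zero] at h5
        simp at h5
      refine ⟨hβW, congrFun (hβk.mod.unique hq (hlt β) (hlt α) hk.mod ?_)⟩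
      have h7 := energy_mul_add_sum_mod q β
      rw [hβW.2, hβW.1.1] at h7
      rw [hα.2, hα.1.1] at hαE
      omega
    ext β
    by_cases hβ : β ∈ bottom q n m s ∧ ∀ t, β t % qChar q = α t % qChar q
    · have h8 := hall (fun t => α t / qChar q) (fun t => β t / qChar q)
        (div_lt_of_mem_index hα.1) (div_lt_of_mem_index hβ.1.1) (hα.2.trans hα₀.2.symm)
        (hβ.1.2.trans hα₀.2.symm) (fun t => α t % qChar q) (hlt α) (hαE.trans hα.1.1)
      rw [comb_div_mod, ← funext hβ.2, comb_div_mod, ScalarAt] at h8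
      rw [h8]
      by_cases h : α = β
      · subst h; simp [mono]
      · simp [mono, h]
    · have h9 : T (mono k α) β = 0 := by
        by_contra h
        exact hβ (hsup β (Finsupp.mem_support_iff.2 h))
      have h : α ≠ β := by rintro rfl; exact hβ ⟨hα, fun _ => rfl⟩
      rw [h9]
      simp [mono, h]
  refine ⟨z, ?_⟩
  -- The remaining monomials are obtained by moving the remainders.
  have hmono : ∀ α ∈ bottom q n m s, T (mono k α) = z • mono k α := by
    intro α hα
    obtain ⟨ρ, hρ, hρk⟩ := exists_killed_of_lt (fun t => α t % qChar q) (hlt α)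
    obtain ⟨hρlt, hρs⟩ := reflTransGen_lt_sum (hlt α) hρ
    have hE := energy_mul_add_sum_mod q α
    have hmem : ∀ σ : Fin n → ℕ, (∀ t, σ t < qChar q) →
        ∑ t, σ t = ∑ t, α t % qChar q → comb (qChar q) (fun t => α t / qChar q) σ ∈
        bottom q n m s := by
      intro σ hσ hσs
      refine cell_subset_bottom (by omega) hα ⟨?_, comb_div hσ⟩
      rw [sum_comb, hσs]
      exact hE
    have := connected_induction hq (P := fun σ => ∑ t, σ t = ∑ t, α t % qChar q ∧
      T (mono k (comb (qChar q) (fun t => α t / qChar q) σ))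
        = z • mono k (comb (qChar q) (fun t => α t / qChar q) σ)) ?_ hρlt (hlt α) hρs
      ⟨hρs, hkilled _ (hmem ρ hρlt hρs) ?_⟩
    · simpa only [comb_div_mod] using this.2
    · rintro σ hσ a b hab ha hb ⟨hσs, hσT⟩
      refine ⟨by rw [sum_shift hab.ne σ hb, hσs], ?_⟩
      have h5 := hT.comm a b hab _ (mono_mem_homog (hmem σ hσ hσs).1)
      rw [hσT, map_smul, moveOp_pos q (by simp [comb, hb]), map_smul, shift_comb hb,
        smul_comm z] at h5
      refine smul_right_injective _ (fun h0 => ?_) h5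
      exact not_dvd_comb_succ ha ((qInt_eq_zero_iff (by omega) _).1 h0)
    · exact killed_of_killed_mod (hmem ρ hρlt hρs) (by rwa [funext (comb_mod hρlt)])
  intro y hy
  have h10 : y ∈ Submodule.span k (mono k '' bottom q n m s) := by
    rw [← monoSub_restrictScalars (hq := by omega) (hX := stable_bottom q n m s)]
    exact hy
  have h11 : Submodule.span k (mono k '' bottom q n m s) ≤ LinearMap.eqLocus T (z • 1) := by
    rw [Submodule.span_le]
    rintro _ ⟨α, hα, rfl⟩
    exact hmono α hα
  exact h11 h10

/-! ### Indecomposability -/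

lemma map_mem_map_socle {R M : Type*} [Ring R] [AddCommGroup M] [Module R M] {N : Submodule R M}
    (f : N →ₗ[R] N) {x : M} (hx : x ∈ (socle R N).map N.subtype) (hxN : x ∈ N) :
    (f ⟨x, hxN⟩ : M) ∈ (socle R N).map N.subtype := by
  have key : socle R N ≤ (socle R N).comap f := by
    refine sSup_le fun S (hS : IsSimpleModule R S) w hw => ?_
    rcases LinearMap.injective_or_eq_zero (f ∘ₗ S.subtype) with h | h
    · have h1 : IsSimpleModule R (LinearMap.range (f ∘ₗ S.subtype)) :=
        IsSimpleModule.congr (LinearEquiv.ofInjective _ h).symm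
      exact (le_sSup h1 : LinearMap.range (f ∘ₗ S.subtype) ≤ socle R N)
        (LinearMap.mem_range_self (f ∘ₗ S.subtype) ⟨w, hw⟩)
    · have h1 : f w = 0 := LinearMap.congr_fun h ⟨w, hw⟩
      rw [Submodule.mem_comap, h1]
      exact zero_mem _
  obtain ⟨y, hy, rfl⟩ := hx
  exact ⟨f y, key hy, rfl⟩

/-- A module is indecomposable if every non-zero submodule meets a submodule `W` on which every
endomorphism is zero or injective. -/
lemma isIndecomposable_of {R M : Type*} [Ring R] [AddCommGroup M] [Module R M] [Nontrivial M]
    (W : Submodule R M) (h1 : ∀ S : Submodule R M, S ≠ ⊥ → ∃ y ∈ S, y ≠ 0 ∧ y ∈ W)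
    (h2 : ∀ f : M →ₗ[R] M, (∀ w ∈ W, f w = 0) ∨ ∀ w ∈ W, f w = 0 → w = 0) :
    IsIndecomposable R M := by
  refine ⟨inferInstance, fun A B hAB => ?_⟩
  by_contra hcon
  push Not at hcon
  obtain ⟨a, ha, ha0, haW⟩ := h1 A hcon.1
  obtain ⟨b, hb, hb0, hbW⟩ := h1 B hcon.2
  have ea : A.projection B hAB a = a := Submodule.projection_apply_left hAB ⟨a, ha⟩
  have eb : A.projection B hAB b = 0 := (Submodule.projection_apply_eq_zero_iff hAB).2 hb
  rcases h2 (A.projection B hAB) with h | h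
  · exact ha0 (ea.symm.trans (h a haW))
  · exact hb0 (h b hbW eb)

/-- The linear extension of an endomorphism of `A_q^{(s)}(n, 𝐦)`. -/
lemma exists_intertwiner {q : kˣ} {n m s : ℕ}
    (f : homog q n m s →ₗ[SmallU q n] homog q n m s) :
    ∃ T : Module.End k (DivPow k n), IsIntertwiner q n m s T ∧
      ∀ y (hy : y ∈ homog q n m s), T y = f ⟨y, hy⟩ := by
  let g : (homog q n m s).restrictScalars k →ₗ[k] DivPow k n :=
    { toFun := fun x => (f ⟨x.1, x.2⟩ : DivPow k n)
      map_add' := fun x y => congrArg Subtype.val (f.map_add ⟨x.1, x.2⟩ ⟨y.1, y.2⟩)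
      map_smul' := fun c x => by
        have h : (⟨(c • x).1, (c • x).2⟩ : homog q n m s)
            = algebraMap k (SmallU q n) c • ⟨x.1, x.2⟩ :=
          Subtype.ext (algebraMap_smul (SmallU q n) c x.1).symm
        rw [h, map_smul]
        exact algebraMap_smul (SmallU q n) c _ }
  obtain ⟨T, hT⟩ := LinearMap.exists_extend g
  have hTf : ∀ y (hy : y ∈ homog q n m s), T y = f ⟨y, hy⟩ := fun y hy =>
    LinearMap.congr_fun hT (⟨y, hy⟩ : (homog q n m s).restrictScalars k)
  refine ⟨T, ⟨fun y hy => ?_, fun a b hab y hy => ?_⟩, hTf⟩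
  · rw [hTf y hy]; exact (f ⟨y, hy⟩).2
  · obtain ⟨x, hx⟩ := exists_gen_of_adj q hab
    have h1 : (⟨moveOp q a b y, moveOp_mem _ hab hy⟩ : homog q n m s) = genu q x • ⟨y, hy⟩ :=
      Subtype.ext ((LinearMap.congr_fun hx y).symm.trans (genu_smul q x y).symm)
    rw [hTf _ (moveOp_mem _ hab hy), h1, map_smul, hTf y hy, ← hx, ← genu_smul]
    rfl

lemma isIndecomposable_homog {q : kˣ} (hq : 2 ≤ qChar q) {n m s : ℕ} (hn : 3 ≤ n)
    (hs : qChar q ≤ s) (hne : (index q n m s).Nonempty) :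
    IsIndecomposable (SmallU q n) (homog q n m s) := by
  have hn2 : 2 ≤ n := by omega
  obtain ⟨α, hα⟩ := hne
  have : Nontrivial (homog q n m s) :=
    ⟨⟨⟨mono k α, mono_mem_homog hα⟩, 0, fun h => mono_ne_zero α (congrArg Subtype.val h)⟩⟩
  have hsoc := soc_eq hq hn2 m s
  refine isIndecomposable_of
    ((monoSub (by omega) (stable_bottom q n m s)).comap (homog q n m s).subtype)
    (fun S hS => ?_) fun f => ?_
  · have hmap : S.map (homog q n m s).subtype ≠ ⊥ := fun h =>
      hS (Submodule.map_injective_of_injective (Submodule.subtype_injective _)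
        (h.trans (Submodule.map_bot _).symm))
    obtain ⟨_, ⟨x, hx, rfl⟩, hy0, hyW⟩ :=
      exists_mem_bottom hq hn2 (Submodule.map_subtype_le _ S) hmap
    exact ⟨x, hx, fun h => hy0 (by rw [h, map_zero]), hyW⟩
  · obtain ⟨T, hT, hTf⟩ := exists_intertwiner f
    obtain ⟨z, hz⟩ := hT.exists_scalar hq hn hs ⟨α, hα⟩ (fun y hy => by
      have hyN := bottom_le_homog (by omega) n m s hy
      rw [hTf y hyN, ← hsoc]
      exact map_mem_map_socle f (by rw [← hsoc] at hy; exact hy) hyN)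
    have hfz : ∀ w : homog q n m s, (w : DivPow k n) ∈ monoSub (by omega) (stable_bottom q n m s) →
        (f w : DivPow k n) = z • (w : DivPow k n) := fun w hw => by
      rw [← hz _ hw, hTf _ w.2]
    by_cases hz0 : z = 0
    · exact Or.inl fun w hw => Subtype.ext (by rw [hfz w hw, hz0, zero_smul]; rfl)
    · refine Or.inr fun w hw hw0 => Subtype.ext ?_
      have := hfz w hw
      rw [hw0] at this
      exact (smul_eq_zero.1 this.symm).resolve_left hz0

/-! ### Highest weight vectors and the decomposition of the socle -/

lemma Killed.isHighestWeightVector {q : kˣ} (hq : 0 < qChar q) {n : ℕ} {α : Fin n → ℕ}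
    (h : Killed (qChar q) α) : IsHighestWeightVector q (cyclic q (mono k α)) (mono k α) := by
  refine ⟨mono_ne_zero α, rfl, fun i => ?_, fun i =>
    ⟨((q ^ ((α (lo i) : ℤ) - (α (hi i) : ℤ)) : kˣ) : k), ?_⟩⟩
  · rw [genu_smul]
    change moveOp q (lo i) (hi i) (mono k α) = 0
    by_cases hb : α (hi i) = 0
    · exact moveOp_zero q hb
    · rw [moveOp_pos q hb, (qInt_eq_zero_iff hq _).2 ((h (lo i) (hi i) rfl).resolve_left hb),
        zero_smul]
  · rw [genu_smul]
    exact diagOp_mono q (lo i) (hi i) α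

lemma soc_eq_cyclic {q : kˣ} (hq : 2 ≤ qChar q) {n m s : ℕ} (hn : 2 ≤ n) {η : Fin n → ℕ}
    (hη : η ∈ bottom q n m s) (h : ∀ α ∈ bottom q n m s, ∀ t, α t / qChar q = η t / qChar q) :
    soc q n m s = cyclic q (mono k η) := by
  rw [soc_eq hq hn]
  refine le_antisymm (monoSub_le fun α hα => ?_) (cyclic_le.2 (mono_mem_monoSub hη))
  exact mono_mem_of_div_eq hq _ (hη.1.1.trans hα.1.1.symm) (fun t => (h α hα t).symm)
    (mem_cyclic q _)

/-- If all exponents in `ℤ_+^n(s, 𝐦)` have the same quotients, then the component is simple. -/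
lemma homog_eq_cyclic {q : kˣ} (hq : 2 ≤ qChar q) {n m s : ℕ} {η : Fin n → ℕ}
    (hη : η ∈ index q n m s) (h : ∀ α ∈ index q n m s, ∀ t, α t / qChar q = η t / qChar q)
    (hk : Killed (qChar q) η) :
    homog q n m s = cyclic q (mono k η) ∧ IsSimpleModule (SmallU q n) (homog q n m s) ∧
      IsHighestWeightVector q (homog q n m s) (mono k η) := by
  have hbot : η ∈ bottom q n m s := by
    obtain ⟨α, hα, he⟩ := exists_energy_eq_minEnergy ⟨η, hη⟩
    exact ⟨hη, by rw [← he]; exact (sum_congr rfl fun t _ => h α hα t).symm⟩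
  have heq : homog q n m s = cyclic q (mono k η) := by
    rw [homog_eq_monoSub (by omega : 0 < qChar q)]
    refine le_antisymm (monoSub_le fun α hα => ?_) (cyclic_le.2 (mono_mem_monoSub hη))
    exact mono_mem_of_div_eq hq _ (hη.1.trans hα.1.symm) (fun t => (h α hα t).symm)
      (mem_cyclic q _)
  rw [heq]
  exact ⟨rfl, isSimpleModule_cyclic_mono hq hbot, hk.isHighestWeightVector (by omega)⟩

lemma sum_etaLow {n : ℕ} (hn : 0 < n) (s : ℕ) : ∑ t, etaLow n s t = s := by
  rw [Fintype.sum_eq_single (⟨0, hn⟩ : Fin n)]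
  · simp [etaLow]
  · intro x hx
    have : x.val ≠ 0 := fun h => hx (Fin.ext h)
    simp [etaLow, this]

lemma killed_etaLow (l n s : ℕ) : Killed l (etaLow n s) := by
  intro a b hab
  left
  have : b.val ≠ 0 := by omega
  simp [etaLow, this]

lemma sum_etaMid {n l j h : ℕ} (hj : j < n) : ∑ t, etaMid n l j h t = j * (l - 1) + h := by
  obtain ⟨d, rfl⟩ := Nat.exists_eq_add_of_lt hj
  simp only [etaMid]
  rw [Fin.sum_univ_eq_sum_range
    (fun i => if i < j then l - 1 else if i = j then h else 0) (j + d + 1),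
    show j + d + 1 = j + 1 + d by ring, sum_range_add, sum_range_succ]
  have h1 : ∑ x ∈ range j, (if x < j then l - 1 else if x = j then h else 0) = j * (l - 1) := by
    rw [sum_congr rfl fun x hx => if_pos (mem_range.1 hx)]
    simp
  have h2 : ∑ x ∈ range d, (if j + 1 + x < j then l - 1 else if j + 1 + x = j then h else 0)
      = 0 := sum_eq_zero fun x _ => by rw [if_neg (by omega), if_neg (by omega)]
  rw [h1, h2]
  simp

lemma etaMid_lt {n l j h : ℕ} (hl : 0 < l) (hh : h < l) (t : Fin n) : etaMid n l j h t < l := by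
  simp only [etaMid]
  split_ifs <;> omega

lemma killed_etaMid {n l j h : ℕ} (hl : 0 < l) : Killed l (etaMid n l j h) := by
  intro a b hab
  by_cases ha : a.val < j
  · right
    simp only [etaMid, if_pos ha]
    exact dvd_of_eq (by omega)
  · left
    simp only [etaMid]
    rw [if_neg (by omega), if_neg (by omega)]

/-- The remainders of `etaHigh`. -/
def etaRem (n l h : ℕ) : Fin n → ℕ := fun i => if i.val + 1 = n then h else l - 1

lemma etaHigh_eq_comb {n : ℕ} (l h : ℕ) (κ : Fin n → ℕ) :
    etaHigh l h κ = comb l κ (etaRem n l h) := rfl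

lemma etaRem_lt {n l h : ℕ} (hl : 0 < l) (hh : h < l) (t : Fin n) : etaRem n l h t < l := by
  simp only [etaRem]
  split_ifs <;> omega

lemma sum_etaRem {n : ℕ} (l h : ℕ) (hn : 0 < n) :
    ∑ t, etaRem n l h t = (n - 1) * (l - 1) + h := by
  obtain ⟨n, rfl⟩ := Nat.exists_eq_succ_of_ne_zero hn.ne'
  rw [Fin.sum_univ_castSucc]
  have h1 : ∀ x : Fin n, etaRem (n + 1) l h x.castSucc = l - 1 := fun x => by
    have := x.2
    simp only [etaRem, Fin.val_castSucc]
    rw [if_neg (by omega)]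
  rw [sum_congr rfl fun x _ => h1 x]
  simp [etaRem]

lemma killed_etaHigh {n l : ℕ} (hl : 0 < l) (h : ℕ) (κ : Fin n → ℕ) :
    Killed l (etaHigh l h κ) := by
  intro a b hab
  right
  have := b.2
  simp only [etaHigh]
  rw [if_neg (by omega), add_assoc, Nat.sub_add_cancel hl]
  exact Dvd.intro_left (κ a + 1) (by ring)

/-- The monomials of minimal energy whose quotients are not the given ones. -/
lemma stable_bottom_div_ne {q : kˣ} (hq : 0 < qChar q) {n m s : ℕ} (κ : Fin n → ℕ) :
    Stable q {β | β ∈ bottom q n m s ∧ (fun t => β t / qChar q) ≠ κ} := by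
  rintro β ⟨hβ, hne⟩ a b hab hb ha
  have h1 := stable_cell hq hβ β ⟨rfl, fun _ => rfl⟩ a b hab hb ha
  exact ⟨cell_subset_bottom hq hβ h1, by rwa [funext h1.2]⟩

/-- The cyclic modules generated by monomials of minimal energy with different quotients are
independent. -/
lemma iSupIndep_cyclic {q : kˣ} (hq : 2 ≤ qChar q) {n m s : ℕ} {ι : Type*}
    (η : ι → Fin n → ℕ) (hη : ∀ x, η x ∈ bottom q n m s)
    (hinj : ∀ x y, (∀ t, η x t / qChar q = η y t / qChar q) → x = y) :
    iSupIndep fun x => cyclic q (mono k (η x)) := by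
  intro x
  rw [Submodule.disjoint_def]
  intro y hy hy'
  have hle : ⨆ (x') (_ : x' ≠ x), cyclic q (mono k (η x'))
      ≤ monoSub (by omega) (stable_bottom_div_ne (s := s) (m := m) (by omega)
        (fun t => η x t / qChar q)) :=
    iSup₂_le fun x' hx' => cyclic_le.2 (mono_mem_monoSub
      ⟨hη x', fun h => hx' (hinj x' x (congrFun h))⟩)
  have h1 := mem_monoSub.1 (hle hy')
  replace hy : y ∈ cyclic q (mono k (η x)) := hy
  rw [cyclic_mono_eq hq (hη x)] at hy
  have h2 := mem_monoSub.1 hy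
  rw [← Finsupp.support_eq_empty, eq_empty_iff_forall_notMem]
  exact fun α hα => (h1 α hα).2 (funext (h2 α hα).2)

/-- There are at least two exponents of degree `r` with entries at most `c`, unless `r` is `0` or
the largest possible degree. -/
lemma exists_ne_of_sum_eq {n c r : ℕ} (hn : 2 ≤ n) (hr : 1 ≤ r) (hrc : r < n * c) :
    ∃ κ κ' : Fin n → ℕ, κ ≠ κ' ∧ (∑ i, κ i = r ∧ ∀ i, κ i ≤ c) ∧
      (∑ i, κ' i = r ∧ ∀ i, κ' i ≤ c) := by
  obtain ⟨κ, h1, h2⟩ := exists_sum_eq (fun _ : Fin n => c) r (by simpa using hrc.le)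
  have key : ∀ i j : Fin n, i ≠ j → κ i < c → κ j ≠ 0 →
      ∃ κ κ' : Fin n → ℕ, κ ≠ κ' ∧ (∑ i, κ i = r ∧ ∀ i, κ i ≤ c) ∧
        (∑ i, κ' i = r ∧ ∀ i, κ' i ≤ c) := by
    intro i j hij hi hj
    refine ⟨κ, shift i j κ, fun h => ?_, ⟨h2, h1⟩, by rw [sum_shift hij κ hj, h2], fun t => ?_⟩
    · have := congrFun h i
      rw [shift_src hij] at this
      omega
    · have := h1 t
      simp only [shift]
      split_ifs <;> subst_vars <;> omega
  obtain ⟨i, -, hi⟩ := exists_lt_of_sum_lt (s := univ) (f := κ) (g := fun _ : Fin n => c)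
    (by simpa [h2] using hrc)
  obtain ⟨j, hj⟩ : ∃ j, κ j ≠ 0 := by
    by_contra hcon
    push Not at hcon
    rw [sum_eq_zero fun t _ => hcon t] at h2
    omega
  by_cases hij : i = j
  · subst hij
    obtain ⟨x, hx⟩ := exists_adj hn i
    rcases Nat.lt_or_ge (κ x) c with hxc | hxc
    · exact key x i hx.ne hxc hj
    · exact key i x hx.ne.symm hi (by omega)
  · exact key i j hij hi hj

lemma not_isSimpleModule_of_two {q : kˣ} (hq : 2 ≤ qChar q) {n m s : ℕ} (hn : 2 ≤ n)
    {α β : Fin n → ℕ} (hα : α ∈ bottom q n m s) (hβ : β ∈ bottom q n m s)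
    (hne : ∃ t, α t / qChar q ≠ β t / qChar q) :
    ¬ IsSimpleModule (SmallU q n) (soc q n m s) := by
  rw [isSimpleModule_iff_isAtom]
  intro hatom
  have key : ∀ γ ∈ bottom q n m s, cyclic q (mono k γ) = soc q n m s := by
    intro γ hγ
    refine (hatom.le_iff.1 ?_).resolve_left fun h => ?_
    · rw [soc_eq hq hn]
      exact cyclic_le.2 (mono_mem_monoSub hγ)
    · exact mono_ne_zero γ ((Submodule.mem_bot (SmallU q n)).1 (h ▸ mem_cyclic q _))
  have h1 : mono k α ∈ cyclic q (mono k β) := by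
    rw [key β hβ, ← key α hα]
    exact mem_cyclic q _
  rw [cyclic_mono_eq hq hβ, mem_monoSub] at h1
  obtain ⟨t, ht⟩ := hne
  exact ht ((h1 α (by simp [support_mono])).2 t)

end QDP

theorem theorem3p8 {k : Type*} [Field k] [IsAlgClosed k] [CharZero k] (q : kˣ) (n m s ℓ : ℕ)
    (hn : 3 ≤ n) (hq : QDP.qChar q = ℓ) (hℓ : 3 ≤ ℓ) (hm : 1 ≤ m) (hs : s ≤ n * (m * ℓ - 1)) :
    -- (1) vectors generating a simple submodule have the minimal energy degree
    (∀ y ∈ QDP.homog q n m s, y ≠ 0 → IsSimpleModule (QDP.SmallU q n) (QDP.cyclic q y) →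
      QDP.edeg q y = QDP.minEnergy q n m s) ∧
    -- (2) the socle is spanned by the monomials of minimal energy degree
    ((QDP.soc q n m s).restrictScalars k =
      Submodule.span k
        (QDP.mono k '' {α ∈ QDP.index q n m s | QDP.energy q α = QDP.minEnergy q n m s})) ∧
    -- (3) the monomials of maximal energy degree generate the module
    (QDP.homog q n m s =
      ⨆ α ∈ {α ∈ QDP.index q n m s | QDP.energy q α = QDP.maxEnergy q n m s},
        QDP.cyclic q (QDP.mono k α)) ∧
    -- (4) the two extreme ranges, where the module is simple
    (s ≤ ℓ - 1 →
      QDP.homog q n m s = QDP.cyclic q (QDP.mono k (QDP.etaLow n s)) ∧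
      IsSimpleModule (QDP.SmallU q n) (QDP.homog q n m s) ∧
      QDP.IsHighestWeightVector q (QDP.homog q n m s) (QDP.mono k (QDP.etaLow n s))) ∧
    (n * (m * ℓ - 1) - (ℓ - 1) ≤ s →
      ∃ h : ℕ, h ≤ ℓ - 1 ∧ s = n * (m - 1) * ℓ + (n - 1) * (ℓ - 1) + h ∧
        QDP.homog q n m s = QDP.cyclic q (QDP.mono k (QDP.etaHigh (n := n) ℓ h fun _ => m - 1)) ∧
        IsSimpleModule (QDP.SmallU q n) (QDP.homog q n m s) ∧
        QDP.IsHighestWeightVector q (QDP.homog q n m s)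
          (QDP.mono k (QDP.etaHigh (n := n) ℓ h fun _ => m - 1))) ∧
    -- (5) the middle range, where the module is indecomposable
    (ℓ ≤ s → s + ℓ ≤ n * (m * ℓ - 1) →
      QDP.IsIndecomposable (QDP.SmallU q n) (QDP.homog q n m s)) ∧
    -- (5)(i)
    ((ℓ - 1) + 1 ≤ s → s ≤ n * (ℓ - 1) →
      ∃ j h : ℕ, 1 ≤ j ∧ j < n ∧ 1 ≤ h ∧ h ≤ ℓ - 1 ∧ s = j * (ℓ - 1) + h ∧
        QDP.soc q n m s = QDP.cyclic q (QDP.mono k (QDP.etaMid n ℓ j h)) ∧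
        IsSimpleModule (QDP.SmallU q n) (QDP.soc q n m s) ∧
        QDP.IsHighestWeightVector q (QDP.soc q n m s) (QDP.mono k (QDP.etaMid n ℓ j h))) ∧
    -- (5)(ii)
    (n * (ℓ - 1) + 1 ≤ s → s + ℓ ≤ n * (m * ℓ - 1) →
      ∃ r h : ℕ, 1 ≤ r ∧ r ≤ n * (m - 1) - 1 ∧ h ≤ ℓ - 1 ∧
        s = r * ℓ + h + (n - 1) * (ℓ - 1) ∧
        iSupIndep (fun κ : {κ : Fin n → ℕ // ∑ i, κ i = r ∧ ∀ i, κ i ≤ m - 1} =>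
          QDP.cyclic q (QDP.mono k (QDP.etaHigh ℓ h κ.1))) ∧
        QDP.soc q n m s =
          (⨆ κ : {κ : Fin n → ℕ // ∑ i, κ i = r ∧ ∀ i, κ i ≤ m - 1},
            QDP.cyclic q (QDP.mono k (QDP.etaHigh ℓ h κ.1))) ∧
        ¬ IsSimpleModule (QDP.SmallU q n) (QDP.soc q n m s) ∧
        ∀ κ : {κ : Fin n → ℕ // ∑ i, κ i = r ∧ ∀ i, κ i ≤ m - 1},
          QDP.IsHighestWeightVector q (QDP.cyclic q (QDP.mono k (QDP.etaHigh ℓ h κ.1)))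
            (QDP.mono k (QDP.etaHigh ℓ h κ.1))) := by
  subst hq
  have hq0 : 0 < QDP.qChar q := by omega
  have hq2 : 2 ≤ QDP.qChar q := by omega
  have hn2 : 2 ≤ n := by omega
  have hlm : QDP.qChar q ≤ m * QDP.qChar q := Nat.le_mul_of_pos_left _ hm
  have hne := QDP.index_nonempty (by omega) hs
  -- The largest possible degree in terms of quotients and remainders.
  have hN : n * (m * QDP.qChar q - 1)
      = n * (m - 1) * QDP.qChar q + (n - 1) * (QDP.qChar q - 1) + (QDP.qChar q - 1) := by
    obtain ⟨m, rfl⟩ := Nat.exists_eq_succ_of_ne_zero (by omega : m ≠ 0)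
    obtain ⟨n, rfl⟩ := Nat.exists_eq_succ_of_ne_zero (by omega : n ≠ 0)
    obtain ⟨l, hl⟩ := Nat.exists_eq_succ_of_ne_zero hq0.ne'
    rw [hl]
    have : (m + 1) * (l + 1) - 1 = m * (l + 1) + l := by
      rw [add_mul, one_mul]; omega
    simp only [Nat.succ_eq_add_one, this, Nat.add_sub_cancel]
    ring
  have hn1 : n * (QDP.qChar q - 1) = (n - 1) * (QDP.qChar q - 1) + (QDP.qChar q - 1) := by
    conv_lhs => rw [← Nat.sub_add_cancel (by omega : 1 ≤ n)]
    rw [add_mul, one_mul]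
  refine ⟨?_, ?_, ?_, ?_, ?_, ?_, ?_, ?_⟩
  · intro y hy hy0 hsimple
    exact QDP.edeg_eq_minEnergy hq0 hy0
      (QDP.le_bottom_of_isSimpleModule hq2 hn2 (QDP.cyclic_le.2 hy) hsimple (QDP.mem_cyclic q y))
  · rw [QDP.soc_eq hq2 hn2, QDP.monoSub_restrictScalars]
    rfl
  · exact QDP.homog_eq_iSup_maxEnergy hq2 hn2
  · intro hsl
    have hsum := QDP.sum_etaLow (by omega : 0 < n) s
    have hle : ∀ α : Fin n → ℕ, ∑ t, α t = s → ∀ t, α t < QDP.qChar q := fun α hα t => by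
      have : α t ≤ ∑ x, α x :=
        Finset.single_le_sum (fun _ _ => Nat.zero_le _) (Finset.mem_univ t)
      omega
    have hidx : QDP.etaLow n s ∈ QDP.index q n m s :=
      ⟨hsum, fun t => (hle _ hsum t).trans_le hlm⟩
    refine QDP.homog_eq_cyclic hq2 hidx (fun α hα t => ?_) (QDP.killed_etaLow _ n s)
    rw [Nat.div_eq_of_lt (hle α hα.1 t), Nat.div_eq_of_lt (hle _ hsum t)]
  · intro hsN
    have hh : s - (n * (m - 1) * QDP.qChar q + (n - 1) * (QDP.qChar q - 1)) < QDP.qChar q := by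
      omega
    refine ⟨s - (n * (m - 1) * QDP.qChar q + (n - 1) * (QDP.qChar q - 1)), by omega, by omega, ?_⟩
    set h := s - (n * (m - 1) * QDP.qChar q + (n - 1) * (QDP.qChar q - 1)) with hh'
    have hρ := QDP.etaRem_lt (n := n) hq0 hh
    have hidx : QDP.etaHigh (n := n) (QDP.qChar q) h (fun _ => m - 1) ∈ QDP.index q n m s := by
      rw [QDP.etaHigh_eq_comb]
      refine QDP.comb_mem_index hρ (fun _ => by omega) ?_
      rw [QDP.sum_etaRem _ _ (by omega)]
      simp only [Finset.sum_const, Finset.card_univ, Fintype.card_fin, smul_eq_mul]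
      omega
    refine QDP.homog_eq_cyclic hq2 hidx (fun α hα t => ?_) (QDP.killed_etaHigh hq0 _ _)
    rw [QDP.etaHigh_eq_comb, QDP.comb_div hρ]
    -- The entries of `α` fall short of their maximum by at most `ℓ - 1` altogether.
    have h1 : ∑ x, (m * QDP.qChar q - 1 - α x) + ∑ x, α x = n * (m * QDP.qChar q - 1) := by
      rw [← Finset.sum_add_distrib, Finset.sum_congr rfl fun x _ =>
        Nat.sub_add_cancel (Nat.le_sub_one_of_lt (hα.2 x))]
      simp
    have h2 : m * QDP.qChar q - 1 - α t ≤ ∑ x, (m * QDP.qChar q - 1 - α x) :=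
      Finset.single_le_sum (f := fun x => m * QDP.qChar q - 1 - α x)
        (fun _ _ => Nat.zero_le _) (Finset.mem_univ t)
    have h3 := hα.1
    have h4 := hα.2 t
    have h5 : m * QDP.qChar q = (m - 1) * QDP.qChar q + QDP.qChar q := by
      conv_lhs => rw [← Nat.sub_add_cancel hm]
      rw [add_mul, one_mul]
    refine Nat.div_eq_of_lt_le (by omega) ?_
    rw [Nat.sub_add_cancel hm]
    exact h4
  · intro hsl _
    exact QDP.isIndecomposable_homog hq2 hn hsl hne
  · intro h1 h2
    have hL : 0 < QDP.qChar q - 1 := by omega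
    have hdm := Nat.div_add_mod (s - 1) (QDP.qChar q - 1)
    have hmod := Nat.mod_lt (s - 1) hL
    set j := (s - 1) / (QDP.qChar q - 1) with hj
    set h := (s - 1) % (QDP.qChar q - 1) + 1 with hh
    have hj1 : 1 ≤ j := (Nat.one_le_div_iff hL).2 (by omega)
    have hjn : j < n := (Nat.div_lt_iff_lt_mul hL).2 (by omega)
    have hsjh : s = j * (QDP.qChar q - 1) + h := by rw [mul_comm]; omega
    have hlt := QDP.etaMid_lt (n := n) (j := j) (h := h) hq0 (by omega)
    have hE : QDP.energy q (QDP.etaMid n (QDP.qChar q) j h) = 0 :=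
      Finset.sum_eq_zero fun t _ => Nat.div_eq_of_lt (hlt t)
    have hidx : QDP.etaMid n (QDP.qChar q) j h ∈ QDP.index q n m s :=
      ⟨by rw [QDP.sum_etaMid hjn, hsjh], fun t => (hlt t).trans_le hlm⟩
    have hmin : QDP.minEnergy q n m s = 0 := Nat.le_zero.1 (hE ▸ QDP.minEnergy_le hidx)
    have hbot : QDP.etaMid n (QDP.qChar q) j h ∈ QDP.bottom q n m s := ⟨hidx, by rw [hE, hmin]⟩
    have hsoc : QDP.soc q n m s = QDP.cyclic q (QDP.mono k (QDP.etaMid n (QDP.qChar q) j h)) := by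
      refine QDP.soc_eq_cyclic hq2 hn2 hbot fun α hα t => ?_
      have h3 : QDP.energy q α = 0 := hα.2.trans hmin
      rw [Nat.div_eq_of_lt (hlt t)]
      exact Finset.sum_eq_zero_iff.1 h3 t (Finset.mem_univ t)
    refine ⟨j, h, hj1, hjn, by omega, by omega, hsjh, hsoc, ?_, ?_⟩
    · rw [hsoc]
      exact QDP.isSimpleModule_cyclic_mono hq2 hbot
    · rw [hsoc]
      exact (QDP.killed_etaMid hq0).isHighestWeightVector hq0
  · intro h1 h2
    have hdm := Nat.div_add_mod (s - (n - 1) * (QDP.qChar q - 1)) (QDP.qChar q)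
    have hmod := Nat.mod_lt (s - (n - 1) * (QDP.qChar q - 1)) hq0
    set r := (s - (n - 1) * (QDP.qChar q - 1)) / QDP.qChar q with hr
    set h := (s - (n - 1) * (QDP.qChar q - 1)) % QDP.qChar q with hh
    have hr1 : 1 ≤ r := (Nat.one_le_div_iff hq0).2 (by omega)
    have hrn : r < n * (m - 1) := (Nat.div_lt_iff_lt_mul hq0).2 (by omega)
    have hsr : s = r * QDP.qChar q + h + (n - 1) * (QDP.qChar q - 1) := by
      rw [mul_comm r]; omega
    have hρ := QDP.etaRem_lt (n := n) hq0 hmod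
    have hmin : ∀ α ∈ QDP.index q n m s, r ≤ QDP.energy q α := by
      intro α hα
      by_contra hcon
      have h3 : (QDP.energy q α + 1) * QDP.qChar q ≤ r * QDP.qChar q :=
        Nat.mul_le_mul_right _ (not_le.1 hcon)
      have h4 := QDP.energy_mul_add_sum_mod q α
      have h5 := QDP.sum_mod_le hq0 α
      rw [hα.1] at h4
      rw [add_mul] at h3
      omega
    have hidx : ∀ κ : Fin n → ℕ, (∑ i, κ i = r ∧ ∀ i, κ i ≤ m - 1) →
        QDP.etaHigh (QDP.qChar q) h κ ∈ QDP.index q n m s := by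
      intro κ hκ
      rw [QDP.etaHigh_eq_comb]
      refine QDP.comb_mem_index hρ (fun t => by have := hκ.2 t; omega) ?_
      rw [QDP.sum_etaRem _ _ (by omega), hκ.1]
      omega
    have hE : ∀ κ : Fin n → ℕ, QDP.energy q (QDP.etaHigh (QDP.qChar q) h κ) = ∑ i, κ i :=
      fun κ => QDP.energy_comb hρ
    have hdiv : ∀ (κ : Fin n → ℕ) t, QDP.etaHigh (QDP.qChar q) h κ t / QDP.qChar q = κ t :=
      fun κ t => QDP.comb_div hρ t
    obtain ⟨κ₁, κ₂, hκne, hκ₁, hκ₂⟩ := QDP.exists_ne_of_sum_eq hn2 hr1 hrn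
    have hminE : QDP.minEnergy q n m s = r := by
      obtain ⟨α, hα, he⟩ := QDP.exists_energy_eq_minEnergy hne
      refine le_antisymm ?_ (he ▸ hmin α hα)
      rw [← hκ₁.1, ← hE κ₁]
      exact QDP.minEnergy_le (hidx κ₁ hκ₁)
    have hbot : ∀ κ : Fin n → ℕ, (∑ i, κ i = r ∧ ∀ i, κ i ≤ m - 1) →
        QDP.etaHigh (QDP.qChar q) h κ ∈ QDP.bottom q n m s := fun κ hκ =>
      ⟨hidx κ hκ, by rw [hE, hκ.1, hminE]⟩
    refine ⟨r, h, hr1, by omega, by omega, hsr, ?_, ?_, ?_, fun κ => ?_⟩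
    · refine QDP.iSupIndep_cyclic hq2 (m := m) (s := s) _ (fun κ => hbot κ.1 κ.2) ?_
      intro κ κ' hκ
      simp only [hdiv] at hκ
      exact Subtype.ext (funext hκ)
    · rw [QDP.soc_eq hq2 hn2]
      refine le_antisymm (QDP.monoSub_le fun α hα => ?_)
        (iSup_le fun κ => QDP.cyclic_le.2 (QDP.mono_mem_monoSub (hbot κ.1 κ.2)))
      have hκ : ∑ i, α i / QDP.qChar q = r ∧ ∀ i, α i / QDP.qChar q ≤ m - 1 :=
        ⟨hα.2.trans hminE, fun i => Nat.le_sub_one_of_lt (QDP.div_lt_of_mem_index hα.1 i)⟩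
      have hle := le_iSup (fun κ : {κ : Fin n → ℕ // ∑ i, κ i = r ∧ ∀ i, κ i ≤ m - 1} =>
        QDP.cyclic q (QDP.mono k (QDP.etaHigh (QDP.qChar q) h κ.1))) ⟨_, hκ⟩
      refine QDP.mono_mem_of_div_eq hq2 _ ?_ (fun t => hdiv _ t) (hle (QDP.mem_cyclic q _))
      exact (hidx _ hκ).1.trans hα.1.1.symm
    · refine QDP.not_isSimpleModule_of_two hq2 hn2 (hbot κ₁ hκ₁) (hbot κ₂ hκ₂) ?_
      by_contra hcon
      push Not at hcon
      simp only [hdiv] at hcon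
      exact hκne (funext hcon)
    · exact (QDP.killed_etaHigh hq0 h κ.1).isHighestWeightVector hq0
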